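/- Let $m,n\ge 1$ and $0\le\delta<1$. Let $a\in m\text{-}S^0_{1,\delta}$, that is, let $a=a(x,\xi)$ be a smooth complex-valued function on $\mathbb R^n\times(\mathbb R^n)^m$, $\xi=(\xi_1,\dots,\xi_m)$, such that for all multi-indices $\alpha,\beta_1,\dots,\beta_m\in\mathbb N^n$ there is a constant $C>0$ with $$|\partial_x^\alpha\partial_{\xi_1}^{\beta_1}\cdots\partial_{\xi_m}^{\beta_m}a(x,\xi)|\le C\,(1+|\xi_1|+\dots+|\xi_m|)^{\delta|\alpha|-(|\beta_1|+\dots+|\beta_m|)}\qquad\text{for all }x,\xi .$$ For Schwartz functions $f_1,\dots,f_m\in\mathcal S(\mathbb R^n)$ put $$T_a(f_1,\dots,f_m)(x)=\int_{(\mathbb R^n)^m}a(x,\xi)\prod_{j=1}^m\hat f_j(\xi_j)\,e^{i\langle x,\xi_1+\dots+\xi_m\rangle}\,d\xi,\qquad \hat f(\xi)=\int_{\mathbb R^n}f(y)e^{-i\langle y,\xi\rangle}\,dy .$$ Then $T_a$ has an associated kernel satisfying (H1) and (H2) below. That is, there is a function $K(y_0,y_1,\dots,y_m)$, defined off the diagonal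 $y_0=y_1=\dots=y_m$ of $(\mathbb R^n)^{m+1}$, such that for all $f_1,\dots,f_m\in\mathcal S(\mathbb R^n)$ and all $x\notin\bigcap_{j=1}^m\operatorname{supp}f_j$, $$T_a(f_1,\dots,f_m)(x)=\int_{(\mathbb R^n)^m}K(x,y_1,\dots,y_m)f_1(y_1)\cdots f_m(y_m)\,dy_1\cdots dy_m$$ with an absolutely convergent integral, and such that: (H1) for every real $N\ge mn$ there is $C>0$ such that, off the diagonal, $$|K(y_0,y_1,\dots,y_m)|\le\frac{C}{\big(\sum_{k,l=0}^m|y_k-y_l|\big)^{N}};$$ (H2) there is $\epsilon>0$ such that for every $N>0$ there is $C>0$ such that, for all $0\le j\le m$, all $(y_0,\dots,y_m)$ off the diagonal and all $y_j'\in\mathbb R^n$ with $|y_j-y_j'|\le h:=\frac12\max_{0\le k\le m}|y_j-y_k|$, $$|K(y_0,\dots,y_j,\dots,y_m)-K(y_0,\dots,y_j',\dots,y_m)|\le\frac{C|y_j-y_j'|^\epsilon}{\big(\sum_{k,l=0}^m|y_k-y_l|\big)^{mn+\epsilon}}\min\{1,h^{-N}\}.$$ -/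

import Mathlib

open scoped SchwartzMap ContDiff

noncomputable section

namespace MultPsiDO

/-- The Euclidean space `ℝⁿ`. -/
abbrev E (n : ℕ) : Type := EuclideanSpace ℝ (Fin n)

/-- The space `ℝⁿ × (ℝⁿ)ᵐ` of pairs `(x, ξ)`, with `ξ = (ξ₁, …, ξₘ)`, on which symbols live. -/
abbrev Phase (m n : ℕ) : Type := E n × (Fin m → E n)

/-- The coordinate direction of `xᵢ`. -/
def xDir (m : ℕ) {n : ℕ} (i : Fin n) : Phase m n := (EuclideanSpace.single i 1, 0)

/-- The coordinate direction of the `i`-th coordinate of `ξⱼ`. -/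
def xiDir {m n : ℕ} (j : Fin m) (i : Fin n) : Phase m n :=
  (0, Pi.single j (EuclideanSpace.single i 1))

/-- The directional derivative `∂_v F`. -/
def dirDeriv {m n : ℕ} (v : Phase m n) (F : Phase m n → ℂ) : Phase m n → ℂ :=
  fun p => lineDeriv ℝ F p v

/-- For a multi-index `α ∈ ℕⁿ` and directions `e₁, …, eₙ`, the derivative
`∂_{e₁}^{α₁} ⋯ ∂_{eₙ}^{αₙ} F`. -/
def multiDeriv {m n : ℕ} (e : Fin n → Phase m n) (α : Fin n → ℕ) (F : Phase m n → ℂ) :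
    Phase m n → ℂ :=
  (List.finRange n).foldr (fun i G => (dirDeriv (e i))^[α i] G) F

/-- The mixed derivative `∂_x^α ∂_{ξ₁}^{β₁} ⋯ ∂_{ξₘ}^{βₘ} a`. -/
def symbolDeriv {m n : ℕ} (α : Fin n → ℕ) (β : Fin m → Fin n → ℕ) (a : Phase m n → ℂ) :
    Phase m n → ℂ :=
  multiDeriv (xDir m) α
    ((List.finRange m).foldr (fun j G => multiDeriv (xiDir j) (β j) G) a)

/-- The Hörmander class `m-S^l_{ρ,δ}` of symbols on `ℝⁿ × (ℝⁿ)ᵐ`. -/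
structure IsSymbol {m n : ℕ} (l ρ δ : ℝ) (a : Phase m n → ℂ) : Prop where
  smooth : ContDiff ℝ ∞ a
  bound : ∀ (α : Fin n → ℕ) (β : Fin m → Fin n → ℕ), ∃ C : ℝ, 0 < C ∧
    ∀ (x : E n) (ξ : Fin m → E n),
      ‖symbolDeriv α β a (x, ξ)‖ ≤
        C * (1 + ∑ j, ‖ξ j‖) ^
          (l + δ * ((∑ i, α i : ℕ) : ℝ) - ρ * ((∑ j, ∑ i, β j i : ℕ) : ℝ))

/-- The Fourier transform `f̂(ξ) = ∫ f(y) e^{-i⟨y, ξ⟩} dy` (no factor `2π` in the phase). -/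
def hat {n : ℕ} (f : E n → ℂ) (ξ : E n) : ℂ :=
  ∫ y : E n, f y * Complex.exp (-Complex.I * ((inner ℝ y ξ : ℝ) : ℂ))

/-- The multilinear pseudodifferential operator
`T_a(f₁, …, fₘ)(x) = ∫ a(x, ξ) f̂₁(ξ₁) ⋯ f̂ₘ(ξₘ) e^{i⟨x, ξ₁ + ⋯ + ξₘ⟩} dξ`. -/
def psiDO {m n : ℕ} (a : Phase m n → ℂ) (f : Fin m → 𝓢(E n, ℂ)) (x : E n) : ℂ :=
  ∫ ξ : Fin m → E n,
    a (x, ξ) * (∏ j, hat (f j) (ξ j)) *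
      Complex.exp (Complex.I * ((inner ℝ x (∑ j, ξ j) : ℝ) : ℂ))

/-- `y = (y₀, y₁, …, yₘ)` does not lie on the diagonal `y₀ = y₁ = ⋯ = yₘ`. -/
def OffDiag {m n : ℕ} (y : Fin (m + 1) → E n) : Prop := ∃ k l, y k ≠ y l

/-- `K(y₀, y₁, …, yₘ)` is an associated kernel of `T`: for `x ∉ ⋂ⱼ supp fⱼ`, the integral of
`K(x, y₁, …, yₘ) f₁(y₁) ⋯ fₘ(yₘ)` converges absolutely and equals `T(f₁, …, fₘ)(x)`.
The values of `K` on the diagonal are irrelevant here, since the product vanishes there. -/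
def IsAssociatedKernel {m n : ℕ} (T : (Fin m → 𝓢(E n, ℂ)) → E n → ℂ)
    (K : (Fin (m + 1) → E n) → ℂ) : Prop :=
  ∀ (f : Fin m → 𝓢(E n, ℂ)) (x : E n), x ∉ ⋂ j, tsupport (f j) →
    MeasureTheory.Integrable (fun y : Fin m → E n => K (Fin.cons x y) * ∏ j, f j (y j)) ∧
    T f x = ∫ y : Fin m → E n, K (Fin.cons x y) * ∏ j, f j (y j)

/-- `∑_{k,l=0}^m |y_k - y_l|`. -/
def spread {m n : ℕ} (y : Fin (m + 1) → E n) : ℝ := ∑ k, ∑ l, ‖y k - y l‖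

/-- `h = ½ max_{0 ≤ k ≤ m} |y_j - y_k|`. -/
def halfMax {m n : ℕ} (y : Fin (m + 1) → E n) (j : Fin (m + 1)) : ℝ :=
  (1 / 2) * Finset.univ.sup' Finset.univ_nonempty (fun k => ‖y j - y k‖)

/-- The decay condition: for every `N ≥ mn` there is `C` with
`|K(y₀, …, yₘ)| ≤ C / (∑ |y_k - y_l|)^N` off the diagonal. -/
def DecayCondition {m n : ℕ} (K : (Fin (m + 1) → E n) → ℂ) : Prop :=
  ∀ N : ℝ, (m : ℝ) * n ≤ N → ∃ C : ℝ, 0 < C ∧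
    ∀ y : Fin (m + 1) → E n, OffDiag y → ‖K y‖ ≤ C / spread y ^ N

/-- The smoothness condition; `Function.update y j z` is `(y₀, …, y_j', …, yₘ)` with
`y_j' = z`. The exponent `ε` is the same for all `N`. -/
def SmoothnessCondition {m n : ℕ} (K : (Fin (m + 1) → E n) → ℂ) : Prop :=
  ∃ ε : ℝ, 0 < ε ∧ ∀ N : ℝ, 0 < N → ∃ C : ℝ, 0 < C ∧
    ∀ (j : Fin (m + 1)) (y : Fin (m + 1) → E n) (z : E n), OffDiag y →
      ‖y j - z‖ ≤ halfMax y j →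
      ‖K y - K (Function.update y j z)‖ ≤
        C * ‖y j - z‖ ^ ε / spread y ^ ((m : ℝ) * n + ε) * min 1 (halfMax y j ^ (-N))

end MultPsiDO

end

open scoped SchwartzMap ContDiff

noncomputable section

namespace MultPsiDO

open MeasureTheory Filter
open scoped Topology FourierTransform

/-! ### Iterated finite differences -/

/-! The kernel should be the oscillatory integral of `a(x, ξ) e^{i⟨z, ξ⟩}` over `ξ`, with `z = (x -
y₁, …, x - yₘ)`, which does not converge absolutely. Finite differences replace integration by
parts. If `v` satisfies `e^{-i⟨z, v⟩} = -1`, then moving `Δ_v` from the symbol to the exponential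
multiplies the integral by `-2`. Hence `(-2)^{-M} ∫ Δ_v^M a(x, ξ) e^{i⟨z, ξ⟩} dξ` does not depend on
`M` or `v` as long as it converges (`integral_fwdDiff_mul_phase_eq`), and serves as the definition.

Take `v = τ c` with `c` a coordinate vector and `|τ|` of size at most a constant over `|z|`. For a
symbol of order `l` in `ξ`, the `M`-th difference is dominated by `(|τ| / W)^M W^l`, where `W =
max(1, |τ|) + |ξ|` (`SymbolBound.diffBound_mul`). With `M = N + 1` and `N ≥ mn + l` this integrates
to a multiple of `|τ|^N` (`integral_weight_le`), hence to `|z|^{-N}`. No dyadic decomposition is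
needed, even at the critical exponent. This is (H1).

For (H2), with `ε = 1`, the kernel with frozen `x` is Lipschitz in `z` with one more power of decay.
A change of `x` replaces the symbol by `a(x, ·) - a(x', ·)`, which is `|x - x'|` times a symbol of
order `δ ≤ 1`, so the size estimate with `l = 1` applies.

The kernel represents `T_a` by Fubini for symbols with a cutoff in `ξ`. Removing the cutoff uses
symbol bounds uniform in the cutoff and the positive distance from `x` to some `supp f_j`. -/

lemma hasDerivAt_fwdDiff_iter {f f' : ℝ → ℂ} (hf : ∀ t, HasDerivAt f (f' t) t) (τ : ℝ) (M : ℕ) :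
    ∀ t, HasDerivAt ((fwdDiff τ)^[M] f) ((fwdDiff τ)^[M] f' t) t := by
  induction M generalizing f f' with
  | zero => simpa using hf
  | succ M ih =>
    simp only [Function.iterate_succ_apply]
    refine ih fun t => ?_
    have h1 : HasDerivAt (fun t => f (t + τ)) (f' (t + τ)) t := (hf (t + τ)).comp_add_const t τ
    exact h1.sub (hf t)

/-- A product version of `‖Δ_τ^M φ‖ ≤ |τ|^M sup ‖φ^(M)‖`, where `φ k` is the `k`-th derivative of
`φ 0` and similarly for `ψ`. -/
theorem norm_fwdDiff_iter_mul_le {s : ℝ} (hs : 0 ≤ s) (τ : ℝ) (M : ℕ) :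
    ∀ {φ ψ : ℕ → ℝ → ℂ} {A B t₀ : ℝ}, 0 ≤ A → 0 ≤ B →
    (∀ k t, HasDerivAt (φ k) (φ (k + 1) t) t) →
    (∀ k t, HasDerivAt (ψ k) (ψ (k + 1) t) t) →
    (∀ k ≤ M, ∀ t, |t - t₀| ≤ M * |τ| → ‖φ k t‖ ≤ A * s ^ k) →
    (∀ k ≤ M, ∀ t, |t - t₀| ≤ M * |τ| → ‖ψ k t‖ ≤ B * s ^ k) →
    ‖(fwdDiff τ)^[M] (fun t => φ 0 t * ψ 0 t) t₀‖ ≤ (2 * |τ| * s) ^ M * (A * B) := by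
  induction M with
  | zero =>
    intro φ ψ A B t₀ hA hB _ _ h1 h2
    have h1' := h1 0 le_rfl t₀ (by simp)
    have h2' := h2 0 le_rfl t₀ (by simp)
    simp only [pow_zero, mul_one, Function.iterate_zero, id, one_mul, norm_mul] at *
    gcongr
  | succ M ih =>
    intro φ ψ A B t₀ hA hB hφ hψ h1 h2
    -- One difference is traded for one derivative by the mean value inequality. The two Leibniz
    -- terms give the factor `2`, and the differentiated factor contributes `s`.
    have hd : ∀ t, HasDerivAt (fun t => φ 0 t * ψ 0 t)
        (((fun t => φ 1 t * ψ 0 t) + fun t => φ 0 t * ψ 1 t) t) t :=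
      fun t => (hφ 0 t).mul (hψ 0 t)
    have hD := hasDerivAt_fwdDiff_iter hd τ M
    have hb : ∀ t ∈ Set.uIcc t₀ (t₀ + τ),
        ‖(fwdDiff τ)^[M] ((fun t => φ 1 t * ψ 0 t) + fun t => φ 0 t * ψ 1 t) t‖
          ≤ 2 * s * ((2 * |τ| * s) ^ M * (A * B)) := by
      intro t ht
      have htt : |t - t₀| ≤ |τ| := by
        have := Set.abs_sub_left_of_mem_uIcc ht
        simpa using this
      have hsub : ∀ r, |r - t| ≤ M * |τ| → |r - t₀| ≤ (M + 1 : ℕ) * |τ| := by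
        intro r hr
        have := abs_sub_le r t t₀
        push_cast
        linarith
      rw [fwdDiff_iter_add]
      have e1 := ih (φ := fun k => φ (k + 1)) (ψ := ψ) (A := A * s) (B := B) (t₀ := t)
        (by positivity) hB (fun k => hφ (k + 1)) hψ
        (fun k hk r hr => (h1 (k + 1) (by omega) r (hsub r hr)).trans (by rw [pow_succ]; linarith))
        (fun k hk r hr => h2 k (by omega) r (hsub r hr))
      have e2 := ih (φ := φ) (ψ := fun k => ψ (k + 1)) (A := A) (B := B * s) (t₀ := t)
        hA (by positivity) hφ (fun k => hψ (k + 1))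
        (fun k hk r hr => h1 k (by omega) r (hsub r hr))
        (fun k hk r hr => (h2 (k + 1) (by omega) r (hsub r hr)).trans (by rw [pow_succ]; linarith))
      simp only [zero_add] at e1 e2
      refine (norm_add_le _ _).trans ((add_le_add e1 e2).trans (le_of_eq ?_))
      ring
    have key := Convex.norm_image_sub_le_of_norm_hasDerivWithin_le
      (fun t _ => (hD t).hasDerivWithinAt) hb (convex_uIcc t₀ (t₀ + τ))
      Set.left_mem_uIcc Set.right_mem_uIcc
    rw [Function.iterate_succ_apply']
    refine key.trans (le_of_eq ?_)
    rw [add_sub_cancel_left, Real.norm_eq_abs]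
    ring

lemma fwdDiff_iter_line {V : Type*} [AddCommGroup V] [Module ℝ V] (b : V → ℂ) (ξ v : V) (τ : ℝ)
    (M : ℕ) (t : ℝ) :
    (fwdDiff τ)^[M] (fun r : ℝ => b (ξ + r • v)) t = (fwdDiff (τ • v))^[M] b (ξ + t • v) := by
  induction M generalizing b with
  | zero => rfl
  | succ M ih =>
    rw [Function.iterate_succ_apply, Function.iterate_succ_apply, ← ih]
    have h : fwdDiff τ (fun r : ℝ => b (ξ + r • v)) =
        fun r : ℝ => fwdDiff (τ • v) b (ξ + r • v) := by
      funext r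
      simp only [fwdDiff, add_smul, add_assoc]
    rw [h]

lemma norm_fwdDiff_iter_le {V : Type*} [NormedAddCommGroup V] {f : V → ℂ} (v : V) {B : ℝ} (M : ℕ) :
    ∀ {ξ : V}, (∀ η : V, ‖η - ξ‖ ≤ M * ‖v‖ → ‖f η‖ ≤ B) →
      ‖(fwdDiff v)^[M] f ξ‖ ≤ 2 ^ M * B := by
  induction M with
  | zero => intro ξ h; simpa using h ξ (by simp)
  | succ M ih =>
    intro ξ h
    rw [Function.iterate_succ_apply']
    have h1 : ‖(fwdDiff v)^[M] f (ξ + v)‖ ≤ 2 ^ M * B := ih fun η hη => h η <| by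
      have : η - ξ = (η - (ξ + v)) + v := by abel
      rw [this]
      refine (norm_add_le _ _).trans ?_
      push_cast
      linarith
    have h2 : ‖(fwdDiff v)^[M] f ξ‖ ≤ 2 ^ M * B := ih fun η hη => h η <| by
      push_cast
      linarith [norm_nonneg v]
    refine (norm_sub_le _ _).trans ?_
    rw [pow_succ]
    linarith

lemma fwdDiff_iter_comm {V : Type*} [AddCommGroup V] (v w : V) (k l : ℕ) (f : V → ℂ) :
    (fwdDiff v)^[k] ((fwdDiff w)^[l] f) = (fwdDiff w)^[l] ((fwdDiff v)^[k] f) := by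
  have : Function.Commute (fwdDiff (G := ℂ) v) (fwdDiff w) := fun f => by
    ext x
    simp only [fwdDiff, add_right_comm x v w]
    ring
  exact (this.iterate_iterate k l) f

lemma fwdDiff_iter_sub {V : Type*} [AddCommGroup V] (v : V) (k : ℕ) (f g : V → ℂ) :
    (fwdDiff v)^[k] (f - g) = (fwdDiff v)^[k] f - (fwdDiff v)^[k] g := by
  have h := fwdDiff_iter_add v (f - g) g k
  rw [sub_add_cancel] at h
  rw [h, add_sub_cancel_right]

lemma continuous_fwdDiff_iter {V : Type*} [NormedAddCommGroup V] (v : V) (k : ℕ) {f : V → ℂ}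
    (hf : Continuous f) : Continuous ((fwdDiff v)^[k] f) := by
  induction k generalizing f with
  | zero => exact hf
  | succ k ih =>
    rw [Function.iterate_succ_apply]
    refine ih ?_
    unfold fwdDiff
    fun_prop

/-! ### Symbol estimates and difference estimates -/

/-- The `i`-th coordinate vector of the `j`-th factor. -/
def coordVec {m n : ℕ} (j : Fin m) (i : Fin n) : Fin m → E n :=
  Pi.single j (EuclideanSpace.single i 1)

lemma norm_coordVec {m n : ℕ} (j : Fin m) (i : Fin n) : ‖coordVec j i‖ = 1 := by
  simp [coordVec, Pi.norm_single]

/-- The estimates `‖∂_c^k b(ξ)‖ ≤ A (1 + ‖ξ‖)^(l - k)`, `k ≤ M`, in the coordinate directions. -/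
def SymbolBound {m n : ℕ} (M : ℕ) (A : ℝ) (l : ℕ) (b : (Fin m → E n) → ℂ) : Prop :=
  ∀ (j : Fin m) (i : Fin n), ∃ D : ℕ → (Fin m → E n) → ℂ, D 0 = b ∧
    (∀ k ξ (t : ℝ), HasDerivAt (fun r : ℝ => D k (ξ + r • coordVec j i))
      (D (k + 1) (ξ + t • coordVec j i)) t) ∧
    ∀ k ≤ M, ∀ ξ, ‖D k ξ‖ ≤ A * (1 + ‖ξ‖) ^ l / (1 + ‖ξ‖) ^ k

/-- The estimates of the `M`-th order finite differences that follow from `SymbolBound`. -/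
def DiffBound {m n : ℕ} (M : ℕ) (A : ℝ) (l : ℕ) (b : (Fin m → E n) → ℂ) : Prop :=
  ∀ (j : Fin m) (i : Fin n) (τ : ℝ) (ξ : Fin m → E n),
    ‖(fwdDiff (τ • coordVec j i))^[M] b ξ‖ ≤
      A * (|τ| / (max 1 |τ| + ‖ξ‖)) ^ M * (max 1 |τ| + ‖ξ‖) ^ l

theorem SymbolBound.diffBound_mul {m n M l : ℕ} {A B : ℝ} {b χ : (Fin m → E n) → ℂ}
    (hM : 1 ≤ M) (hA : 0 ≤ A) (hB : 0 ≤ B) (hb : SymbolBound M A l b) (hχ : SymbolBound M B 0 χ) :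
    DiffBound M ((4 * M + 8) ^ M * (1 + M) ^ l * (A * B)) l (fun ξ => b ξ * χ ξ) := by
  intro j i τ ξ
  obtain ⟨D, hD0, hD, hDb⟩ := hb j i
  obtain ⟨F, hF0, hF, hFb⟩ := hχ j i
  set v : Fin m → E n := coordVec j i with hv
  have hv1 : ‖v‖ = 1 := norm_coordVec j i
  set W : ℝ := max 1 |τ| + ‖ξ‖ with hW
  have hW1 : 1 ≤ W := by
    have := le_max_left 1 |τ|
    have := norm_nonneg ξ
    linarith
  have hWτ : |τ| ≤ W := by
    have := le_max_right 1 |τ|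
    have := norm_nonneg ξ
    linarith
  have hWξ : 1 + ‖ξ‖ ≤ W := by
    have := le_max_left 1 |τ|
    linarith
  have hM0 : (0 : ℝ) ≤ M := Nat.cast_nonneg M
  have hup : ∀ η : Fin m → E n, ‖η - ξ‖ ≤ M * |τ| → 1 + ‖η‖ ≤ (1 + M) * W := by
    intro η hη
    have h1 : ‖η‖ ≤ ‖η - ξ‖ + ‖ξ‖ := by simpa using norm_add_le (η - ξ) ξ
    have h2 : (M : ℝ) * |τ| ≤ M * W := by gcongr
    linarith
  -- The constant `4M + 8` covers both regimes: `s = 2` from the triangle inequality and `s = 2|τ|(M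
  -- + 4)/W` from the derivatives.
  have hfin : ∀ {s : ℝ}, 0 ≤ s → s ≤ (4 * M + 8) * (|τ| / W) →
      s ^ M * (A * ((1 + M) * W) ^ l * B) ≤
        (4 * M + 8) ^ M * (1 + M) ^ l * (A * B) * (|τ| / W) ^ M * W ^ l := by
    intro s hs0 hs
    calc s ^ M * (A * ((1 + M) * W) ^ l * B)
        ≤ ((4 * M + 8) * (|τ| / W)) ^ M * (A * ((1 + M) * W) ^ l * B) := by gcongr
      _ = _ := by rw [mul_pow, mul_pow]; ring
  by_cases hcase : ‖ξ‖ < 2 * M * |τ| ∧ 1 < |τ|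
  · obtain ⟨h1, h2⟩ := hcase
    have hWM : W ≤ (2 * M + 1) * |τ| := by
      rw [hW, max_eq_right h2.le]; linarith
    have hτ0 : 0 < |τ| := by linarith
    have h3 : ∀ η : Fin m → E n, ‖η - ξ‖ ≤ M * ‖τ • v‖ →
        ‖b η * χ η‖ ≤ A * ((1 + M) * W) ^ l * B := by
      intro η hη
      rw [norm_smul, hv1, mul_one, Real.norm_eq_abs] at hη
      have e1 := hDb 0 (Nat.zero_le _) η
      have e2 := hFb 0 (Nat.zero_le _) η
      rw [hD0, pow_zero, div_one] at e1
      rw [hF0, pow_zero, div_one, mul_one] at e2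
      rw [norm_mul]
      have := hup η hη
      have e3 : A * (1 + ‖η‖) ^ l ≤ A * ((1 + M) * W) ^ l := by gcongr
      have e4 := e1.trans e3
      gcongr
    refine (norm_fwdDiff_iter_le (τ • v) M h3).trans (hfin (by norm_num) ?_)
    rw [mul_div_assoc', le_div_iff₀ (by linarith)]
    nlinarith
  · have hlow : ∀ η : Fin m → E n, ‖η - ξ‖ ≤ M * |τ| → W ≤ (M + 4) * (1 + ‖η‖) := by
      intro η hη
      have h1 : ‖ξ‖ ≤ ‖η - ξ‖ + ‖η‖ := by
        have := norm_sub_le η (η - ξ)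
        simp only [sub_sub_cancel] at this
        linarith
      rcases le_or_gt |τ| 1 with h2 | h2
      · rw [hW, max_eq_left h2]
        have : (M : ℝ) * |τ| ≤ M := by nlinarith
        nlinarith [norm_nonneg η]
      · have h3 : 2 * M * |τ| ≤ ‖ξ‖ := by
          by_contra hc
          exact hcase ⟨not_le.mp hc, h2⟩
        rw [hW, max_eq_right h2.le]
        have hM1 : (1 : ℝ) ≤ M := by exact_mod_cast hM
        have h5 : 1 * |τ| ≤ M * |τ| := by gcongr
        have h4 : ‖ξ‖ ≤ 2 * ‖η‖ := by linarith
        nlinarith [norm_nonneg η]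
    have hs0 : 0 ≤ (M + 4) / W := by positivity
    have hin : ∀ t : ℝ, |t - 0| ≤ M * |τ| → ‖ξ + t • v - ξ‖ ≤ M * |τ| := by
      intro t ht
      rwa [add_sub_cancel_left, norm_smul, hv1, mul_one, Real.norm_eq_abs, ← sub_zero t]
    have hinv : ∀ η : Fin m → E n, ‖η - ξ‖ ≤ M * |τ| → (1 + ‖η‖)⁻¹ ≤ (M + 4) / W := by
      intro η hη
      rw [inv_eq_one_div, div_le_div_iff₀ (by positivity) (by linarith)]
      linarith [hlow η hη]
    have key := norm_fwdDiff_iter_mul_le hs0 τ M (φ := fun k t => D k (ξ + t • v))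
      (ψ := fun k t => F k (ξ + t • v)) (A := A * ((1 + M) * W) ^ l) (B := B) (t₀ := 0)
      (by positivity) hB (fun k => hD k ξ) (fun k => hF k ξ)
      (fun k hk t ht => by
        have h1 := hup _ (hin t ht)
        have h2 := hinv _ (hin t ht)
        refine (hDb k hk _).trans ?_
        rw [div_eq_mul_inv, ← inv_pow]
        gcongr)
      (fun k hk t ht => by
        have h2 := hinv _ (hin t ht)
        refine (hFb k hk _).trans ?_
        rw [pow_zero, mul_one, div_eq_mul_inv, ← inv_pow]
        gcongr)
    have hline := fwdDiff_iter_line (fun η => b η * χ η) ξ v τ M 0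
    rw [zero_smul, add_zero] at hline
    simp only [hD0, hF0] at key
    rw [← hline]
    refine key.trans (hfin (by positivity) ?_)
    have : 0 ≤ |τ| / W := by positivity
    calc 2 * |τ| * ((M + 4) / W) = (2 * M + 8) * (|τ| / W) := by ring
      _ ≤ _ := by gcongr; linarith

lemma SymbolBound.one {m n M : ℕ} : SymbolBound M 1 0 (fun _ : Fin m → E n => (1 : ℂ)) := by
  intro j i
  refine ⟨fun k _ => if k = 0 then 1 else 0, by simp, fun k ξ t => ?_, fun k _ ξ => ?_⟩
  · simpa using hasDerivAt_const t _
  · rcases eq_or_ne k 0 with rfl | hk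
    · simp
    · simp only [hk, if_false, norm_zero]
      positivity

theorem SymbolBound.diffBound {m n M l : ℕ} {A : ℝ} {b : (Fin m → E n) → ℂ} (hM : 1 ≤ M)
    (hA : 0 ≤ A) (hb : SymbolBound M A l b) :
    DiffBound M ((4 * M + 8) ^ M * (1 + M) ^ l * A) l b := by
  simpa using hb.diffBound_mul hM hA zero_le_one SymbolBound.one

/-! ### Integrals of the weights -/

lemma finrank_freq (m n : ℕ) : Module.finrank ℝ (Fin m → E n) = m * n := by
  rw [Module.finrank_pi_fintype]; simp

lemma weight_eq {T P r : ℝ} (hP : 0 < P) (hr : 0 ≤ r) (N l : ℕ) :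
    (T / (P + P * r)) ^ N * (P + P * r) ^ l =
      T ^ N * P ^ l / P ^ N * ((1 + r) ^ l / (1 + r) ^ N) := by
  have : 0 < 1 + r := by linarith
  rw [show P + P * r = P * (1 + r) by ring, div_pow, mul_pow, mul_pow]
  field_simp

lemma integrable_japanese {m n N l : ℕ} (h : m * n + l < N) :
    Integrable (fun ξ : Fin m → E n => (1 + ‖ξ‖) ^ l / (1 + ‖ξ‖) ^ N) := by
  have hr : (Module.finrank ℝ (Fin m → E n) : ℝ) < ((N - l : ℕ) : ℝ) := by
    rw [finrank_freq]
    exact_mod_cast (by omega : m * n < N - l)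
  refine (integrable_one_add_norm (μ := volume) hr).congr (Filter.Eventually.of_forall fun ξ => ?_)
  have h1 : 0 < 1 + ‖ξ‖ := by positivity
  simp only
  rw [Real.rpow_neg h1.le, Real.rpow_natCast, inv_eq_one_div,
    div_eq_div_iff (by positivity) (by positivity), one_mul, ← pow_add]
  congr 1
  omega

lemma weight_smul {m n N l : ℕ} {T P : ℝ} (hP : 0 < P) (η : Fin m → E n) :
    (T / (P + ‖P • η‖)) ^ N * (P + ‖P • η‖) ^ l =
      T ^ N * P ^ l / P ^ N * ((1 + ‖η‖) ^ l / (1 + ‖η‖) ^ N) := by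
  rw [norm_smul, Real.norm_of_nonneg hP.le, weight_eq hP (norm_nonneg η)]

lemma integrable_weight {m n N l : ℕ} {T P : ℝ} (hP : 0 < P) (h : m * n + l < N) :
    Integrable (fun ξ : Fin m → E n => (T / (P + ‖ξ‖)) ^ N * (P + ‖ξ‖) ^ l) := by
  rw [← integrable_comp_smul_iff volume _ hP.ne']
  simp only [weight_smul hP]
  exact (integrable_japanese h).const_mul _

/-- Rescaling by `P = max 1 T` produces `T ^ (N + 1) * P ^ (m * n + l - N - 1)`, which is at most `T
^ N` because `P ≥ 1` and `P ≥ T`. The one extra difference makes the critical case `N = m * n + l`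
integrable. -/
lemma integral_weight_le {m n N l : ℕ} (h : m * n + l ≤ N) {T : ℝ} (hT : 0 ≤ T) :
    ∫ ξ : Fin m → E n, (T / (max 1 T + ‖ξ‖)) ^ (N + 1) * (max 1 T + ‖ξ‖) ^ l ≤
      (∫ ξ : Fin m → E n, (1 + ‖ξ‖) ^ l / (1 + ‖ξ‖) ^ (N + 1)) * T ^ N := by
  set J := ∫ ξ : Fin m → E n, (1 + ‖ξ‖) ^ l / (1 + ‖ξ‖) ^ (N + 1) with hJ
  have hJ0 : 0 ≤ J := integral_nonneg fun ξ => by positivity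
  set P := max 1 T with hPdef
  have hP1 : 1 ≤ P := le_max_left _ _
  have hP : 0 < P := by linarith
  have h1 := Measure.integral_comp_smul (volume : Measure (Fin m → E n))
    (fun ξ => (T / (P + ‖ξ‖)) ^ (N + 1) * (P + ‖ξ‖) ^ l) P
  simp only [weight_smul hP] at h1
  rw [integral_const_mul, finrank_freq, abs_of_pos (by positivity), smul_eq_mul,
    eq_inv_mul_iff_mul_eq₀ (by positivity)] at h1
  rw [← h1]
  have h2 : P ^ (m * n) * (T ^ (N + 1) * P ^ l / P ^ (N + 1)) ≤ T ^ N := by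
    rw [mul_div_assoc', div_le_iff₀ (by positivity)]
    have h4 : T ^ (N + 1) * P ^ N ≤ T ^ N * P ^ (N + 1) := by
      have : T ≤ P := le_max_right _ _
      rw [pow_succ, pow_succ]
      have : 0 ≤ T ^ N * P ^ N := by positivity
      nlinarith
    have h5 : T ^ (N + 1) * P ^ (m * n + l) ≤ T ^ (N + 1) * P ^ N := by gcongr
    calc P ^ (m * n) * (T ^ (N + 1) * P ^ l) = T ^ (N + 1) * P ^ (m * n + l) := by ring
      _ ≤ _ := h5.trans h4
  calc _ = (P ^ (m * n) * (T ^ (N + 1) * P ^ l / P ^ (N + 1))) * J := by ring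
    _ ≤ T ^ N * J := by gcongr
    _ = _ := mul_comm _ _

/-! ### Oscillatory factors -/

/-- The oscillatory factor `e^{i⟨z, ξ⟩}`. -/
def phase {m n : ℕ} (z ξ : Fin m → E n) : ℂ :=
  Complex.exp (Complex.I * ((∑ j, inner ℝ (z j) (ξ j) : ℝ) : ℂ))

lemma norm_phase {m n : ℕ} (z ξ : Fin m → E n) : ‖phase z ξ‖ = 1 :=
  Complex.norm_exp_I_mul_ofReal _

lemma phase_add {m n : ℕ} (z ξ η : Fin m → E n) : phase z (ξ + η) = phase z ξ * phase z η := by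
  simp only [phase, Pi.add_apply, inner_add_right, Finset.sum_add_distrib, Complex.ofReal_add,
    mul_add, Complex.exp_add]

lemma phase_add_left {m n : ℕ} (z w ξ : Fin m → E n) :
    phase (z + w) ξ = phase z ξ * phase w ξ := by
  simp only [phase, Pi.add_apply, inner_add_left, Finset.sum_add_distrib, Complex.ofReal_add,
    mul_add, Complex.exp_add]

lemma continuous_phase_right {m n : ℕ} (z : Fin m → E n) : Continuous (phase z) := by
  unfold phase
  fun_prop

lemma norm_phase_sub_le {m n : ℕ} (z w ξ : Fin m → E n) :
    ‖phase z ξ - phase w ξ‖ ≤ m * (‖z - w‖ * ‖ξ‖) := by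
  have h : phase z ξ - phase w ξ = phase w ξ * (phase (z - w) ξ - 1) := by
    rw [mul_sub, ← phase_add_left]; simp
  rw [h, norm_mul, norm_phase, one_mul]
  refine (Real.norm_exp_I_mul_ofReal_sub_one_le).trans ?_
  refine (norm_sum_le _ _).trans ?_
  have : ∀ j ∈ Finset.univ, ‖(inner ℝ ((z - w) j) (ξ j) : ℝ)‖ ≤ ‖z - w‖ * ‖ξ‖ := fun j _ =>
    (norm_inner_le_norm _ _).trans
      (mul_le_mul (norm_le_pi_norm _ _) (norm_le_pi_norm _ _) (norm_nonneg _) (norm_nonneg _))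
  simpa using Finset.sum_le_card_nsmul _ _ _ this

lemma phase_neg_smul_coordVec {m n : ℕ} (z : Fin m → E n) (τ : ℝ) (j : Fin m) (i : Fin n) :
    phase z (-(τ • coordVec j i)) = Complex.exp (Complex.I * ((-(τ * z j i) : ℝ) : ℂ)) := by
  unfold phase coordVec
  congr 3
  rw [Finset.sum_eq_single j]
  · simp [inner_smul_right, EuclideanSpace.inner_single_right]
  · intro k _ hk
    simp [Pi.single_eq_of_ne hk]
  · simp

lemma integrable_mul_phase {m n : ℕ} {f : (Fin m → E n) → ℂ} (hf : Integrable f)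
    (z : Fin m → E n) : Integrable fun ξ => f ξ * phase z ξ :=
  (Integrable.mul_bdd (c := 1) hf (continuous_phase_right z).aestronglyMeasurable
    (Filter.Eventually.of_forall fun ξ => (norm_phase z ξ).le))

lemma norm_integral_mul_phase_le {m n : ℕ} (f : (Fin m → E n) → ℂ) (z : Fin m → E n) :
    ‖∫ ξ, f ξ * phase z ξ‖ ≤ ∫ ξ, ‖f ξ‖ := by
  refine (norm_integral_le_integral_norm _).trans (le_of_eq ?_)
  simp [norm_phase]

lemma integrable_fwdDiff_iter {m n : ℕ} {f : (Fin m → E n) → ℂ} (hf : Integrable f)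
    (v : Fin m → E n) (k : ℕ) : Integrable ((fwdDiff v)^[k] f) := by
  induction k generalizing f with
  | zero => exact hf
  | succ k ih =>
    rw [Function.iterate_succ_apply]
    exact ih ((hf.comp_add_right v).sub hf)

/-- Summation by parts: translation invariance of the integral turns a shift of `f` by `v` into the
factor `phase z (-v)`. -/
lemma integral_fwdDiff_iter_mul_phase {m n : ℕ} {f : (Fin m → E n) → ℂ} (hf : Integrable f)
    (v z : Fin m → E n) (k : ℕ) :
    ∫ ξ, (fwdDiff v)^[k] f ξ * phase z ξ = (phase z (-v) - 1) ^ k * ∫ ξ, f ξ * phase z ξ := by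
  induction k generalizing f with
  | zero => simp
  | succ k ih =>
    have hd : Integrable (fwdDiff v f) := (hf.comp_add_right v).sub hf
    rw [Function.iterate_succ_apply, ih hd, pow_succ, mul_assoc]
    congr 1
    have h1 : ∫ ξ, f (ξ + v) * phase z ξ = phase z (-v) * ∫ ξ, f ξ * phase z ξ := by
      rw [← integral_add_right_eq_self (fun ξ => f ξ * phase z ξ) v, ← integral_const_mul]
      congr 1
      ext ξ
      have : phase z ξ = phase z (-v) * phase z (ξ + v) := by
        rw [← phase_add]; congr 1; abel
      rw [this]; ring
    simp only [fwdDiff, sub_mul]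
    rw [integral_sub (integrable_mul_phase (hf.comp_add_right v) z) (integrable_mul_phase hf z),
      h1]
    ring

lemma DiffBound.integrable {m n M l : ℕ} {A : ℝ} {b : (Fin m → E n) → ℂ} (hb : DiffBound M A l b)
    (hc : Continuous b) (hM : m * n + l < M) (τ : ℝ) (j : Fin m) (i : Fin n) :
    Integrable ((fwdDiff (τ • coordVec j i))^[M] b) := by
  refine ((integrable_weight (T := |τ|) (P := max 1 |τ|) (by positivity) hM).const_mul A).mono'
    (continuous_fwdDiff_iter _ _ hc).aestronglyMeasurable (Filter.Eventually.of_forall fun ξ => ?_)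
  exact (hb j i τ ξ).trans (le_of_eq (mul_assoc _ _ _))

lemma DiffBound.integral_norm_le {m n N l : ℕ} {A : ℝ} {b : (Fin m → E n) → ℂ} (hA : 0 ≤ A)
    (hb : DiffBound (N + 1) A l b) (hN : m * n + l ≤ N) (τ : ℝ)
    (j : Fin m) (i : Fin n) :
    ∫ ξ, ‖(fwdDiff (τ • coordVec j i))^[N + 1] b ξ‖ ≤
      A * ((∫ ξ : Fin m → E n, (1 + ‖ξ‖) ^ l / (1 + ‖ξ‖) ^ (N + 1)) * |τ| ^ N) := by
  refine (integral_mono_of_nonneg (Filter.Eventually.of_forall fun ξ => norm_nonneg _)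
    ((integrable_weight (T := |τ|) (P := max 1 |τ|) (by positivity) (by omega)).const_mul A)
    (Filter.Eventually.of_forall fun ξ => (hb j i τ ξ).trans (le_of_eq (mul_assoc _ _ _)))).trans ?_
  rw [integral_const_mul]
  exact mul_le_mul_of_nonneg_left (integral_weight_le hN (abs_nonneg τ)) hA

/-- The difference of the phases costs a factor `‖ξ‖`, so the weight is that of order one and one
more difference is spent. -/
lemma DiffBound.norm_integral_phase_sub_le {m n N : ℕ} {A : ℝ} {b : (Fin m → E n) → ℂ}
    (hA : 0 ≤ A) (hb : DiffBound (N + 2) A 0 b) (hc : Continuous b) (hN : m * n ≤ N)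
    (τ : ℝ) (j : Fin m) (i : Fin n) (z w : Fin m → E n) :
    ‖(∫ ξ, (fwdDiff (τ • coordVec j i))^[N + 2] b ξ * phase z ξ) -
      ∫ ξ, (fwdDiff (τ • coordVec j i))^[N + 2] b ξ * phase w ξ‖ ≤
      m * ‖z - w‖ * (A * ((∫ ξ : Fin m → E n, (1 + ‖ξ‖) ^ 1 / (1 + ‖ξ‖) ^ (N + 1 + 1)) *
        |τ| ^ (N + 1))) := by
  have hint : Integrable ((fwdDiff (τ • coordVec j i))^[N + 2] b) :=
    hb.integrable hc (by omega) τ j i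
  rw [← integral_sub (integrable_mul_phase hint z) (integrable_mul_phase hint w)]
  have hp : ∀ ξ, ‖(fwdDiff (τ • coordVec j i))^[N + 2] b ξ * phase z ξ -
      (fwdDiff (τ • coordVec j i))^[N + 2] b ξ * phase w ξ‖ ≤
      m * ‖z - w‖ * (A * ((|τ| / (max 1 |τ| + ‖ξ‖)) ^ (N + 1 + 1) * (max 1 |τ| + ‖ξ‖) ^ 1)) := by
    intro ξ
    rw [← mul_sub, norm_mul]
    have q1 := hb j i τ ξ
    rw [pow_zero, mul_one] at q1
    have q3 : ‖ξ‖ ≤ max 1 |τ| + ‖ξ‖ := le_add_of_nonneg_left (by positivity)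
    have q2 : ‖phase z ξ - phase w ξ‖ ≤ m * (‖z - w‖ * (max 1 |τ| + ‖ξ‖)) :=
      (norm_phase_sub_le z w ξ).trans (by gcongr)
    refine (mul_le_mul q1 q2 (norm_nonneg _) (by positivity)).trans (le_of_eq ?_)
    ring
  have hi := ((integrable_weight (m := m) (n := n) (T := |τ|) (P := max 1 |τ|)
    (N := N + 1 + 1) (l := 1) (by positivity) (by omega)).const_mul A).const_mul (m * ‖z - w‖)
  refine (norm_integral_le_of_norm_le hi (Filter.Eventually.of_forall hp)).trans ?_
  rw [integral_const_mul, integral_const_mul]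
  have q1 := integral_weight_le (m := m) (n := n) (N := N + 1) (l := 1) (by omega) (abs_nonneg τ)
  exact mul_le_mul_of_nonneg_left (mul_le_mul_of_nonneg_left q1 hA) (by positivity)

lemma norm_pow_sub_pow_le {x y : ℂ} {r : ℝ} (hx : ‖x‖ ≤ r) (hy : ‖y‖ ≤ r) (M : ℕ) :
    ‖x ^ (M + 1) - y ^ (M + 1)‖ ≤ (M + 1) * r ^ M * ‖x - y‖ := by
  have hr : 0 ≤ r := (norm_nonneg x).trans hx
  induction M with
  | zero => simp
  | succ M ih =>
    have : x ^ (M + 1 + 1) - y ^ (M + 1 + 1) =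
        x * (x ^ (M + 1) - y ^ (M + 1)) + (x - y) * y ^ (M + 1) := by ring
    rw [this]
    refine (norm_add_le _ _).trans ?_
    rw [norm_mul, norm_mul, norm_pow]
    have h1 : ‖x‖ * ‖x ^ (M + 1) - y ^ (M + 1)‖ ≤ r * ((M + 1) * r ^ M * ‖x - y‖) := by gcongr
    have h2 : ‖x - y‖ * ‖y‖ ^ (M + 1) ≤ ‖x - y‖ * r ^ (M + 1) := by gcongr
    refine (add_le_add h1 h2).trans (le_of_eq ?_)
    push_cast
    ring

/-! ### The kernel of a symbol -/

lemma norm_le_sum_abs {n : ℕ} (x : E n) : ‖x‖ ≤ ∑ i, |x i| := by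
  conv_lhs => rw [← (EuclideanSpace.basisFun (Fin n) ℝ).sum_repr x]
  refine (norm_sum_le _ _).trans (le_of_eq ?_)
  simp [norm_smul]

lemma exists_coord {m n : ℕ} [NeZero m] [NeZero n] (z : Fin m → E n) :
    ∃ c : Fin m × Fin n, ‖z‖ ≤ n * |z c.1 c.2| := by
  obtain ⟨c, hc⟩ := Finite.exists_max fun c : Fin m × Fin n => |z c.1 c.2|
  refine ⟨c, (pi_norm_le_iff_of_nonneg (by positivity)).2 fun j => ?_⟩
  refine (norm_le_sum_abs (z j)).trans ?_
  simpa using Finset.sum_le_card_nsmul Finset.univ (fun i => |z j i|) _ fun i _ => hc (j, i)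

section Kernel

variable {m n : ℕ} [NeZero m] [NeZero n]

/-- An index of a coordinate of `z` comparable to `‖z‖`. -/
def domCoord (z : Fin m → E n) : Fin m × Fin n := (exists_coord z).choose

/-- A step `τ` with `τ z_c = π` for the coordinate `z_c` chosen in `domCoord`. -/
def domStep (z : Fin m → E n) : ℝ := Real.pi / z (domCoord z).1 (domCoord z).2

/-- A vector `v` in a coordinate direction with `e^{-i⟨z, v⟩} = -1` and `‖v‖` comparable
to `‖z‖⁻¹`. -/
def domVec (z : Fin m → E n) : Fin m → E n :=
  domStep z • coordVec (domCoord z).1 (domCoord z).2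

/-- The kernel `∫ b(ξ) e^{i⟨z, ξ⟩} dξ`, `z ≠ 0`, of a symbol of order at most one, as an absolutely
convergent integral. -/
def symbolKernel (b : (Fin m → E n) → ℂ) (z : Fin m → E n) : ℂ :=
  ((-2) ^ (m * n + 2))⁻¹ * ∫ ξ, (fwdDiff (domVec z))^[m * n + 2] b ξ * phase z ξ

lemma domCoord_ne_zero {z : Fin m → E n} (hz : z ≠ 0) : z (domCoord z).1 (domCoord z).2 ≠ 0 := by
  intro h
  have := (exists_coord z).choose_spec
  rw [show (exists_coord z).choose = domCoord z from rfl, h] at this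
  simp at this
  exact hz this

lemma abs_domStep_le {z : Fin m → E n} (hz : z ≠ 0) : |domStep z| ≤ 4 * n / ‖z‖ := by
  have h0 := domCoord_ne_zero hz
  have h := (exists_coord z).choose_spec
  rw [show (exists_coord z).choose = domCoord z from rfl] at h
  unfold domStep
  rw [abs_div, abs_of_pos Real.pi_pos, div_le_div_iff₀ (by positivity) (by positivity)]
  nlinarith [Real.pi_le_four, Real.pi_pos, abs_nonneg (z (domCoord z).1 (domCoord z).2),
    norm_nonneg z, mul_le_mul Real.pi_le_four h (norm_nonneg z) (by norm_num : (0 : ℝ) ≤ 4)]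

lemma phase_neg_domVec {z : Fin m → E n} (hz : z ≠ 0) : phase z (-domVec z) = -1 := by
  unfold domVec
  rw [phase_neg_smul_coordVec, domStep, div_mul_cancel₀ _ (domCoord_ne_zero hz)]
  rw [mul_comm, Complex.ofReal_neg, neg_mul, Complex.exp_neg, Complex.exp_pi_mul_I]
  norm_num

/-- The two difference operators commute, so computing their composition in either order compares an
arbitrary pair `(v, M)` with the pair in the definition. This gives the freedom to take as many
differences as the desired decay requires. -/
theorem integral_fwdDiff_mul_phase_eq {b : (Fin m → E n) → ℂ} {z : Fin m → E n} (hz : z ≠ 0)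
    (h0 : Integrable ((fwdDiff (domVec z))^[m * n + 2] b)) {v : Fin m → E n} {M : ℕ}
    (hM : Integrable ((fwdDiff v)^[M] b)) :
    ∫ ξ, (fwdDiff v)^[M] b ξ * phase z ξ = (phase z (-v) - 1) ^ M * symbolKernel b z := by
  have h1 := integral_fwdDiff_iter_mul_phase hM (domVec z) z (m * n + 2)
  rw [fwdDiff_iter_comm, integral_fwdDiff_iter_mul_phase h0 v z M, phase_neg_domVec hz,
    show (-1 - 1 : ℂ) = -2 by norm_num] at h1
  unfold symbolKernel
  rw [mul_left_comm, h1, inv_mul_cancel_left₀ (by simp)]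

/-- The size estimate for the kernel of a symbol of order `l`. -/
theorem norm_symbolKernel_le {N l : ℕ} (hN : m * n + l ≤ N) : ∃ C : ℝ, 0 ≤ C ∧
    ∀ (b : (Fin m → E n) → ℂ) (A : ℝ) (z : Fin m → E n), Continuous b → 0 ≤ A → z ≠ 0 →
      DiffBound (N + 1) A l b → Integrable ((fwdDiff (domVec z))^[m * n + 2] b) →
      ‖symbolKernel b z‖ ≤ C * A / ‖z‖ ^ N := by
  refine ⟨(∫ ξ : Fin m → E n, (1 + ‖ξ‖) ^ l / (1 + ‖ξ‖) ^ (N + 1)) * (4 * n) ^ N,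
    mul_nonneg (integral_nonneg fun ξ => by positivity) (by positivity), ?_⟩
  intro b A z hc hA hz hb h0
  set J := ∫ ξ : Fin m → E n, (1 + ‖ξ‖) ^ l / (1 + ‖ξ‖) ^ (N + 1) with hJ
  have hJ0 : 0 ≤ J := integral_nonneg fun ξ => by positivity
  have h1 := integral_fwdDiff_mul_phase_eq hz h0 (v := domVec z)
    (hb.integrable hc (by omega) (domStep z) (domCoord z).1 (domCoord z).2)
  have h2 := norm_integral_mul_phase_le ((fwdDiff (domVec z))^[N + 1] b) z
  rw [h1, phase_neg_domVec hz, norm_mul, norm_pow, show ‖(-1 - 1 : ℂ)‖ = 2 by norm_num] at h2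
  have h3 := hb.integral_norm_le hA hN (domStep z) (domCoord z).1 (domCoord z).2
  have h4 := abs_domStep_le hz
  have h5 : (1 : ℝ) ≤ 2 ^ (N + 1) := one_le_pow₀ (by norm_num)
  calc ‖symbolKernel b z‖ ≤ 2 ^ (N + 1) * ‖symbolKernel b z‖ :=
        le_mul_of_one_le_left (norm_nonneg _) h5
    _ ≤ A * (J * |domStep z| ^ N) := h2.trans h3
    _ ≤ A * (J * (4 * n / ‖z‖) ^ N) := by gcongr
    _ = _ := by rw [div_pow]; ring

/-- The Lipschitz estimate for the kernel of a symbol of order zero. -/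
theorem norm_symbolKernel_sub_le {N : ℕ} (hN : m * n ≤ N) {κ : ℝ} (hκ : 0 ≤ κ) : ∃ C : ℝ, 0 ≤ C ∧
    ∀ (b : (Fin m → E n) → ℂ) (A : ℝ) (z w : Fin m → E n), Continuous b → 0 ≤ A →
      z ≠ 0 → w ≠ 0 → ‖z‖ ≤ κ * ‖w‖ →
      DiffBound (N + 1) A 0 b → DiffBound (N + 2) A 0 b → DiffBound (m * n + 2) A 0 b →
      ‖symbolKernel b z - symbolKernel b w‖ ≤ C * A * ‖z - w‖ / ‖z‖ ^ (N + 1) := by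
  obtain ⟨C₀, hC₀, hK⟩ := norm_symbolKernel_le (m := m) (n := n) (l := 0) (N := N) (by omega)
  set J := ∫ ξ : Fin m → E n, (1 + ‖ξ‖) ^ 1 / (1 + ‖ξ‖) ^ (N + 1 + 1) with hJ
  have hJ0 : 0 ≤ J := integral_nonneg fun ξ => by positivity
  clear_value J
  refine ⟨m * (J * (4 * n) ^ (N + 1)) + (N + 2) * 2 ^ (N + 1) * m * (4 * n) * C₀ * κ ^ N,
    by positivity, ?_⟩
  intro b A z w hc hA hz hw hzw hb1 hb2 hb3
  have hz' : 0 < ‖z‖ := norm_pos_iff.2 hz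
  have hw' : 0 < ‖w‖ := norm_pos_iff.2 hw
  -- The step adapted to `z` is used at `w` as well, so the same differenced symbol occurs in both
  -- integrals. At `w` the multiplier is no longer exactly `-2`, but its error is of size `‖z - w‖ /
  -- ‖z‖`.
  set v := domVec z with hv
  have hint : Integrable ((fwdDiff v)^[N + 2] b) :=
    hb2.integrable hc (by omega) (domStep z) (domCoord z).1 (domCoord z).2
  have e1 := integral_fwdDiff_mul_phase_eq hz (hb3.integrable hc (by omega) _ _ _) hint
  have e2 := integral_fwdDiff_mul_phase_eq hw (hb3.integrable hc (by omega) _ _ _) hint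
  rw [phase_neg_domVec hz] at e1
  have hτ := abs_domStep_le hz
  have hvn : ‖v‖ ≤ 4 * n / ‖z‖ := by
    rw [hv, domVec, norm_smul, norm_coordVec, mul_one]; exact hτ
  have d1 : ‖(∫ ξ, (fwdDiff v)^[N + 2] b ξ * phase z ξ) -
      ∫ ξ, (fwdDiff v)^[N + 2] b ξ * phase w ξ‖ ≤
      m * ‖z - w‖ * (A * (J * (4 * n / ‖z‖) ^ (N + 1))) := by
    have q1 := hb2.norm_integral_phase_sub_le hA hc hN (domStep z) (domCoord z).1 (domCoord z).2 z w
    rw [← hJ] at q1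
    refine q1.trans ?_
    gcongr
  have d2 : ‖(phase w (-v) - 1) ^ (N + 1 + 1) - (-1 - 1) ^ (N + 1 + 1)‖ ≤
      ((N + 1 : ℕ) + 1) * 2 ^ (N + 1) * (m * (‖z - w‖ * (4 * n / ‖z‖))) := by
    have hx : ‖phase w (-v) - 1‖ ≤ 2 := by
      refine (norm_sub_le _ _).trans ?_
      rw [norm_phase]; norm_num
    have hd : ‖(phase w (-v) - 1) - (-1 - 1)‖ ≤ m * (‖z - w‖ * (4 * n / ‖z‖)) := by
      rw [sub_sub_sub_cancel_right, ← phase_neg_domVec hz, norm_sub_rev]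
      refine (norm_phase_sub_le _ _ _).trans ?_
      rw [norm_neg]
      gcongr
    exact (norm_pow_sub_pow_le hx (by norm_num) (N + 1)).trans
      (mul_le_mul_of_nonneg_left hd (by positivity))
  have d3 : ‖symbolKernel b w‖ ≤ C₀ * A * κ ^ N / ‖z‖ ^ N := by
    refine (hK b A w hc hA hw hb1 (hb3.integrable hc (by omega) _ _ _)).trans ?_
    rw [div_le_div_iff₀ (by positivity) (by positivity)]
    have : ‖z‖ ^ N ≤ (κ * ‖w‖) ^ N := by gcongr
    rw [mul_pow] at this
    calc C₀ * A * ‖z‖ ^ N ≤ C₀ * A * (κ ^ N * ‖w‖ ^ N) := by gcongr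
      _ = _ := by ring
  -- The first term compares the phases at `z` and `w`; the second corrects the multiplier at `w`
  -- and is paired with the size estimate there.
  have hkey : (-1 - 1) ^ (N + 2) * (symbolKernel b z - symbolKernel b w) =
      ((∫ ξ, (fwdDiff v)^[N + 2] b ξ * phase z ξ) - ∫ ξ, (fwdDiff v)^[N + 2] b ξ * phase w ξ) +
      ((phase w (-v) - 1) ^ (N + 1 + 1) - (-1 - 1) ^ (N + 1 + 1)) * symbolKernel b w := by
    rw [e1, e2]; ring
  have h5 : (1 : ℝ) ≤ 2 ^ (N + 2) := one_le_pow₀ (by norm_num)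
  have h6 := congrArg norm hkey
  rw [norm_mul, norm_pow, show ‖(-1 - 1 : ℂ)‖ = 2 by norm_num] at h6
  calc ‖symbolKernel b z - symbolKernel b w‖
      ≤ 2 ^ (N + 2) * ‖symbolKernel b z - symbolKernel b w‖ :=
        le_mul_of_one_le_left (norm_nonneg _) h5
    _ ≤ m * ‖z - w‖ * (A * (J * (4 * n / ‖z‖) ^ (N + 1))) +
        ((N + 1 : ℕ) + 1) * 2 ^ (N + 1) * (m * (‖z - w‖ * (4 * n / ‖z‖))) *
          (C₀ * A * κ ^ N / ‖z‖ ^ N) := by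
        rw [h6]
        refine (norm_add_le _ _).trans (add_le_add d1 ?_)
        rw [norm_mul]
        exact mul_le_mul d2 d3 (norm_nonneg _) (by positivity)
    _ = _ := by
        rw [div_pow]
        push_cast
        field_simp
        ring

end Kernel

/-! ### Estimates for the sections of a symbol -/

lemma foldr_eq_self {ι β : Type*} (f : ι → β → β) (l : List ι) (b : β)
    (h : ∀ i ∈ l, ∀ b, f i b = b) : l.foldr f b = b := by
  induction l with
  | nil => rfl
  | cons a l ih =>
    rw [List.foldr_cons, ih fun i hi => h i (List.mem_cons_of_mem _ hi), h a List.mem_cons_self]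

lemma foldr_eq_apply {ι β : Type*} (f : ι → β → β) (i₀ : ι)
    (h : ∀ i, i ≠ i₀ → ∀ b, f i b = b) (l : List ι) (hl : l.Nodup) (hi : i₀ ∈ l) (b : β) :
    l.foldr f b = f i₀ b := by
  induction l with
  | nil => simp at hi
  | cons a l ih =>
    rw [List.nodup_cons] at hl
    rw [List.foldr_cons]
    by_cases ha : a = i₀
    · subst ha
      rw [foldr_eq_self f l b fun i hi' => h i fun e => hl.1 (e ▸ hi')]
    · rw [h a ha, ih hl.2 (by simpa [Ne.symm ha] using hi)]

section

variable {m n : ℕ}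

lemma multiDeriv_zero (e : Fin n → Phase m n) (F : Phase m n → ℂ) : multiDeriv e 0 F = F :=
  foldr_eq_self _ _ _ fun _ _ _ => rfl

lemma multiDeriv_single (e : Fin n → Phase m n) (i : Fin n) (k : ℕ) (F : Phase m n → ℂ) :
    multiDeriv e (Pi.single i k) F = (dirDeriv (e i))^[k] F := by
  unfold multiDeriv
  rw [foldr_eq_apply _ i (fun i' hi' b => by simp [Pi.single_eq_of_ne hi']) _
    (List.nodup_finRange n) (List.mem_finRange i), Pi.single_eq_same]

lemma symbolDeriv_single (α : Fin n → ℕ) (j : Fin m) (i : Fin n) (k : ℕ) (a : Phase m n → ℂ) :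
    symbolDeriv α (Pi.single j (Pi.single i k)) a =
      multiDeriv (xDir m) α ((dirDeriv (xiDir j i))^[k] a) := by
  unfold symbolDeriv
  rw [foldr_eq_apply _ j (fun j' hj' b => by
    rw [Pi.single_eq_of_ne hj']; exact multiDeriv_zero _ _) _
    (List.nodup_finRange m) (List.mem_finRange j), Pi.single_eq_same, multiDeriv_single]

lemma dirDeriv_eq_fderiv {F : Phase m n → ℂ} (hF : ContDiff ℝ ∞ F) (v p : Phase m n) :
    dirDeriv v F p = fderiv ℝ F p v :=
  (hF.differentiable (by simp) p).lineDeriv_eq_fderiv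

lemma contDiff_dirDeriv {F : Phase m n → ℂ} (hF : ContDiff ℝ ∞ F) (v : Phase m n) :
    ContDiff ℝ ∞ (dirDeriv v F) := by
  rw [show dirDeriv v F = fun p => fderiv ℝ F p v from funext (dirDeriv_eq_fderiv hF v)]
  exact (hF.fderiv_right (by simp)).clm_apply contDiff_const

lemma contDiff_dirDeriv_iterate {F : Phase m n → ℂ} (hF : ContDiff ℝ ∞ F) (v : Phase m n) (k : ℕ) :
    ContDiff ℝ ∞ ((dirDeriv v)^[k] F) := by
  induction k generalizing F with
  | zero => exact hF
  | succ k ih => exact ih (contDiff_dirDeriv hF v)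

lemma hasDerivAt_dirDeriv {F : Phase m n → ℂ} (hF : ContDiff ℝ ∞ F) (v p : Phase m n) (t : ℝ) :
    HasDerivAt (fun r : ℝ => F (p + r • v)) (dirDeriv v F (p + t • v)) t := by
  rw [dirDeriv_eq_fderiv hF]
  have h1 := (hF.differentiable (by simp) (p + t • v)).hasFDerivAt
  have h2 : HasDerivAt (fun r : ℝ => p + r • v) v t := by
    simpa using ((hasDerivAt_id t).smul_const v).const_add p
  exact h1.comp_hasDerivAt t h2

lemma mk_add_smul_xiDir (x : E n) (ξ : Fin m → E n) (t : ℝ) (j : Fin m) (i : Fin n) :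
    ((x, ξ + t • coordVec j i) : Phase m n) = (x, ξ) + t • xiDir j i := by
  ext <;> simp [xiDir, coordVec]

lemma dirDeriv_fst_eq_sum {F : Phase m n → ℂ} (hF : ContDiff ℝ ∞ F) (u : E n) (p : Phase m n) :
    dirDeriv (u, 0) F p = ∑ i, (u i : ℂ) * dirDeriv (xDir m i) F p := by
  simp only [dirDeriv_eq_fderiv hF]
  have h : ((u, 0) : Phase m n) = ∑ i, u i • xDir m i := by
    have h1 : u = ∑ i, u i • (EuclideanSpace.single i (1 : ℝ) : E n) := by
      simpa using ((EuclideanSpace.basisFun (Fin n) ℝ).sum_repr u).symm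
    refine Prod.ext ?_ ?_
    · rw [Prod.fst_sum]; exact h1
    · rw [Prod.snd_sum]; simp [xDir]
  rw [h, map_sum]
  simp

lemma norm_sub_le_of_dirDeriv_le {F : Phase m n → ℂ} (hF : ContDiff ℝ ∞ F) {B : Fin n → ℝ}
    {ξ : Fin m → E n} (hB : ∀ i x, ‖dirDeriv (xDir m i) F (x, ξ)‖ ≤ B i) (x x' : E n) :
    ‖F (x, ξ) - F (x', ξ)‖ ≤ (∑ i, B i) * ‖x - x'‖ := by
  have hd : ∀ t ∈ Set.Icc (0 : ℝ) 1, ‖dirDeriv (x - x', 0) F ((x', ξ) + t • (x - x', 0))‖ ≤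
      (∑ i, B i) * ‖x - x'‖ := by
    intro t _
    rw [dirDeriv_fst_eq_sum hF, Finset.sum_mul]
    refine norm_sum_le_of_le _ fun i _ => ?_
    rw [norm_mul, mul_comm, Complex.norm_real]
    have h1 : ((x', ξ) + t • (x - x', 0) : Phase m n) = (x' + t • (x - x'), ξ) := by
      ext <;> simp
    rw [h1]
    exact mul_le_mul (hB i _) (PiLp.norm_apply_le (x - x') i) (norm_nonneg _)
      ((norm_nonneg _).trans (hB i 0))
  have h := (convex_Icc (0 : ℝ) 1).norm_image_sub_le_of_norm_hasDerivWithin_le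
    (fun t _ => (hasDerivAt_dirDeriv hF (x - x', 0) (x', ξ) t).hasDerivWithinAt) hd
    (Set.left_mem_Icc.2 zero_le_one) (Set.right_mem_Icc.2 zero_le_one)
  simpa using h

lemma norm_le_sum_norm (ξ : Fin m → E n) : ‖ξ‖ ≤ ∑ j, ‖ξ j‖ :=
  (pi_norm_le_iff_of_nonneg (by positivity)).2 fun j =>
    Finset.single_le_sum (f := fun j => ‖ξ j‖) (fun _ _ => norm_nonneg _) (Finset.mem_univ j)

lemma sum_norm_le (ξ : Fin m → E n) : ∑ j, ‖ξ j‖ ≤ m * ‖ξ‖ := by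
  simpa using Finset.sum_le_card_nsmul Finset.univ (fun j => ‖ξ j‖) _ fun j _ => norm_le_pi_norm ξ j

lemma IsSymbol.symbolBound {δ : ℝ} {a : Phase m n → ℂ} (ha : IsSymbol 0 1 δ a) (M : ℕ) :
    ∃ A : ℝ, 0 ≤ A ∧ ∀ x, SymbolBound M A 0 fun ξ => a (x, ξ) := by
  choose C hC0 hC using fun (k : ℕ) (j : Fin m) (i : Fin n) =>
    ha.bound 0 (Pi.single j (Pi.single i k))
  refine ⟨∑ k ∈ Finset.range (M + 1), ∑ j, ∑ i, C k j i,
    Finset.sum_nonneg fun k _ => Finset.sum_nonneg fun j _ => Finset.sum_nonneg fun i _ =>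
      (hC0 k j i).le, fun x j i => ⟨fun k ξ => (dirDeriv (xiDir j i))^[k] a (x, ξ), rfl, ?_, ?_⟩⟩
  · intro k ξ t
    simp only [mk_add_smul_xiDir, Function.iterate_succ_apply']
    exact hasDerivAt_dirDeriv (contDiff_dirDeriv_iterate ha.smooth _ k) _ _ t
  · intro k hk ξ
    have h1 := hC k j i x ξ
    rw [symbolDeriv_single, multiDeriv_zero] at h1
    have h2 : ∑ j', ∑ i', (Pi.single j (Pi.single i k) : Fin m → Fin n → ℕ) j' i' = k := by
      rw [Finset.sum_eq_single j, Pi.single_eq_same, Finset.sum_pi_single']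
      · simp
      · intro j' _ hj'; simp [Pi.single_eq_of_ne hj']
      · simp
    rw [h2] at h1
    have h3 : (0 : ℝ) + δ * ((∑ i : Fin n, (0 : Fin n → ℕ) i : ℕ) : ℝ) - 1 * (k : ℝ) = -(k : ℝ) := by
      simp
    have hS : 0 ≤ ∑ j, ‖ξ j‖ := by positivity
    rw [h3, Real.rpow_neg (by positivity), Real.rpow_natCast, ← div_eq_mul_inv] at h1
    rw [pow_zero, mul_one]
    have h4 : C k j i ≤ ∑ k ∈ Finset.range (M + 1), ∑ j, ∑ i, C k j i := by
      have e1 : C k j i ≤ ∑ i, C k j i :=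
        Finset.single_le_sum (f := fun i => C k j i) (fun i _ => (hC0 k j i).le) (Finset.mem_univ i)
      have e2 : ∑ i, C k j i ≤ ∑ j, ∑ i, C k j i :=
        Finset.single_le_sum (f := fun j => ∑ i, C k j i)
          (fun j _ => Finset.sum_nonneg fun i _ => (hC0 k j i).le) (Finset.mem_univ j)
      have e3 := Finset.single_le_sum (f := fun k => ∑ j, ∑ i, C k j i) (s := Finset.range (M + 1))
          (fun k _ => Finset.sum_nonneg fun j _ => Finset.sum_nonneg fun i _ => (hC0 k j i).le)
          (Finset.mem_range.2 (Nat.lt_succ_of_le hk))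
      exact e1.trans (e2.trans e3)
    refine h1.trans (div_le_div₀ ((hC0 k j i).le.trans h4) h4 (by positivity) ?_)
    have := norm_le_sum_norm ξ
    gcongr

/-- The mean value inequality in `x` costs one `x`-derivative, hence growth `(1 + |ξ|)^δ`, at most
that of order one. The factor `1 + m` passes from the sum of the `‖ξ j‖` to the sup norm. -/
lemma IsSymbol.symbolBound_sub {δ : ℝ} (hδ : δ ≤ 1) {a : Phase m n → ℂ} (ha : IsSymbol 0 1 δ a)
    (M : ℕ) : ∃ A : ℝ, 0 ≤ A ∧ ∀ x x',
      SymbolBound M (A * ‖x - x'‖) 1 ((fun ξ => a (x, ξ)) - fun ξ => a (x', ξ)) := by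
  choose C hC0 hC using fun (i' : Fin n) (k : ℕ) (j : Fin m) (i : Fin n) =>
    ha.bound (Pi.single i' 1) (Pi.single j (Pi.single i k))
  have hn2 : ∀ k j i, 0 ≤ ∑ i', C i' k j i := fun k j i =>
    Finset.sum_nonneg fun i' _ => (hC0 i' k j i).le
  refine ⟨(1 + m) * ∑ k ∈ Finset.range (M + 1), ∑ j, ∑ i, ∑ i', C i' k j i,
    mul_nonneg (by positivity) (Finset.sum_nonneg fun k _ => Finset.sum_nonneg fun j _ =>
      Finset.sum_nonneg fun i _ => hn2 k j i),
    fun x x' j i => ⟨fun k ξ => (dirDeriv (xiDir j i))^[k] a (x, ξ) -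
      (dirDeriv (xiDir j i))^[k] a (x', ξ), rfl, ?_, ?_⟩⟩
  · intro k ξ t
    simp only [mk_add_smul_xiDir, Function.iterate_succ_apply']
    exact (hasDerivAt_dirDeriv (contDiff_dirDeriv_iterate ha.smooth _ k) _ _ t).sub
      (hasDerivAt_dirDeriv (contDiff_dirDeriv_iterate ha.smooth _ k) _ _ t)
  · intro k hk ξ
    set S := ∑ j, ‖ξ j‖ with hSdef
    have hS : 0 ≤ S := by positivity
    have hSξ := norm_le_sum_norm ξ
    have hSm := sum_norm_le ξ
    have hB : ∀ i' y, ‖dirDeriv (xDir m i') ((dirDeriv (xiDir j i))^[k] a) (y, ξ)‖ ≤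
        C i' k j i * ((1 + m) * (1 + ‖ξ‖) / (1 + ‖ξ‖) ^ k) := by
      intro i' y
      have h1 := hC i' k j i y ξ
      rw [symbolDeriv_single, multiDeriv_single, Function.iterate_one] at h1
      have h2 : ∑ j', ∑ i', (Pi.single j (Pi.single i k) : Fin m → Fin n → ℕ) j' i' = k := by
        rw [Finset.sum_eq_single j, Pi.single_eq_same, Finset.sum_pi_single']
        · simp
        · intro j' _ hj'; simp [Pi.single_eq_of_ne hj']
        · simp
      have h3 : ∑ i₁, (Pi.single i' 1 : Fin n → ℕ) i₁ = 1 := by simp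
      rw [h2, h3] at h1
      refine h1.trans (mul_le_mul_of_nonneg_left ?_ (hC0 i' k j i).le)
      calc (1 + S) ^ (0 + δ * ((1 : ℕ) : ℝ) - 1 * (k : ℝ)) ≤ (1 + S) ^ (1 - (k : ℝ)) :=
            Real.rpow_le_rpow_of_exponent_le (by linarith) (by push_cast; linarith)
        _ = (1 + S) / (1 + S) ^ k := by
            rw [Real.rpow_sub (by positivity), Real.rpow_one, Real.rpow_natCast]
        _ ≤ _ := by
            refine div_le_div₀ (by positivity) ?_ (by positivity) (by gcongr)
            have : (0 : ℝ) ≤ m := Nat.cast_nonneg m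
            nlinarith [norm_nonneg ξ]
    have h := norm_sub_le_of_dirDeriv_le (contDiff_dirDeriv_iterate ha.smooth (xiDir j i) k) hB x x'
    rw [← Finset.sum_mul] at h
    have h4 : ∑ i', C i' k j i ≤ ∑ k ∈ Finset.range (M + 1), ∑ j, ∑ i, ∑ i', C i' k j i := by
      have e1 : ∑ i', C i' k j i ≤ ∑ i, ∑ i', C i' k j i :=
        Finset.single_le_sum (f := fun i => ∑ i', C i' k j i) (fun i _ => hn2 k j i)
          (Finset.mem_univ i)
      have e2 : ∑ i, ∑ i', C i' k j i ≤ ∑ j, ∑ i, ∑ i', C i' k j i :=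
        Finset.single_le_sum (f := fun j => ∑ i, ∑ i', C i' k j i)
          (fun j _ => Finset.sum_nonneg fun i _ => hn2 k j i) (Finset.mem_univ j)
      have e3 := Finset.single_le_sum (f := fun k => ∑ j, ∑ i, ∑ i', C i' k j i)
          (s := Finset.range (M + 1))
          (fun k _ => Finset.sum_nonneg fun j _ => Finset.sum_nonneg fun i _ => hn2 k j i)
          (Finset.mem_range.2 (Nat.lt_succ_of_le hk))
      exact e1.trans (e2.trans e3)
    refine h.trans ?_
    rw [pow_one]
    calc (∑ i', C i' k j i) * ((1 + m) * (1 + ‖ξ‖) / (1 + ‖ξ‖) ^ k) * ‖x - x'‖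
        ≤ (∑ k ∈ Finset.range (M + 1), ∑ j, ∑ i, ∑ i', C i' k j i) *
          ((1 + m) * (1 + ‖ξ‖) / (1 + ‖ξ‖) ^ k) * ‖x - x'‖ := by gcongr
      _ = _ := by ring

lemma IsSymbol.continuous_section {δ : ℝ} {a : Phase m n → ℂ} (ha : IsSymbol 0 1 δ a) (x : E n) :
    Continuous fun ξ => a (x, ξ) :=
  ha.smooth.continuous.comp (by fun_prop)

lemma IsSymbol.diffBound {δ : ℝ} {a : Phase m n → ℂ} (ha : IsSymbol 0 1 δ a) {M : ℕ}
    (hM : 1 ≤ M) : ∃ A : ℝ, 0 ≤ A ∧ ∀ x, DiffBound M A 0 fun ξ => a (x, ξ) := by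
  obtain ⟨A, hA, h⟩ := ha.symbolBound M
  exact ⟨_, by positivity, fun x => (h x).diffBound hM hA⟩

lemma IsSymbol.diffBound_sub {δ : ℝ} (hδ : δ ≤ 1) {a : Phase m n → ℂ} (ha : IsSymbol 0 1 δ a)
    {M : ℕ} (hM : 1 ≤ M) : ∃ A : ℝ, 0 ≤ A ∧ ∀ x x',
      DiffBound M (A * ‖x - x'‖) 1 ((fun ξ => a (x, ξ)) - fun ξ => a (x', ξ)) := by
  obtain ⟨A, hA, h⟩ := ha.symbolBound_sub hδ M
  refine ⟨(4 * M + 8) ^ M * (1 + M) ^ 1 * A, by positivity, fun x x' => ?_⟩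
  rw [mul_assoc]
  exact (h x x').diffBound hM (by positivity)

end

/-! ### Comparison of the distances to the diagonal -/

section

variable {m n : ℕ}

/-- The differences `(y₀ - y₁, …, y₀ - yₘ)`. -/
def diffs (y : Fin (m + 1) → E n) : Fin m → E n := fun j => y 0 - y j.succ

lemma norm_zero_sub_le (y : Fin (m + 1) → E n) (k : Fin (m + 1)) : ‖y 0 - y k‖ ≤ ‖diffs y‖ := by
  refine Fin.cases (by simp) (fun j => ?_) k
  exact norm_le_pi_norm (diffs y) j

lemma norm_sub_le_two_mul (y : Fin (m + 1) → E n) (k l : Fin (m + 1)) :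
    ‖y k - y l‖ ≤ 2 * ‖diffs y‖ := by
  have h1 := norm_zero_sub_le y k
  have h2 := norm_zero_sub_le y l
  have h3 := norm_sub_le (y 0 - y l) (y 0 - y k)
  rw [sub_sub_sub_cancel_left] at h3
  linarith

lemma OffDiag.diffs_ne_zero {y : Fin (m + 1) → E n} (hy : OffDiag y) : diffs y ≠ 0 := by
  obtain ⟨k, l, h⟩ := hy
  intro h0
  have := norm_sub_le_two_mul y k l
  rw [h0, norm_zero, mul_zero, norm_le_zero_iff, sub_eq_zero] at this
  exact h this

lemma spread_le (y : Fin (m + 1) → E n) : spread y ≤ 2 * (m + 1) ^ 2 * ‖diffs y‖ := by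
  have h : ∀ k ∈ Finset.univ, ∑ l, ‖y k - y l‖ ≤ (m + 1) * (2 * ‖diffs y‖) := fun k _ => by
    simpa using Finset.sum_le_card_nsmul Finset.univ (fun l => ‖y k - y l‖) _
      fun l _ => norm_sub_le_two_mul y k l
  have h2 := Finset.sum_le_card_nsmul Finset.univ _ _ h
  simp only [Finset.card_univ, Fintype.card_fin, nsmul_eq_mul, Nat.cast_add, Nat.cast_one] at h2
  unfold spread
  linarith

lemma norm_diffs_le_spread (y : Fin (m + 1) → E n) : ‖diffs y‖ ≤ spread y := by
  refine (pi_norm_le_iff_of_nonneg (by unfold spread; positivity)).2 fun j => ?_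
  have h1 := Finset.single_le_sum (f := fun l => ‖y 0 - y l‖) (fun _ _ => norm_nonneg _)
    (Finset.mem_univ j.succ)
  have h2 := Finset.single_le_sum (f := fun k => ∑ l, ‖y k - y l‖)
    (fun k _ => Finset.sum_nonneg fun _ _ => norm_nonneg _) (Finset.mem_univ (0 : Fin (m + 1)))
  exact h1.trans h2

lemma norm_sub_le_halfMax (y : Fin (m + 1) → E n) (j k : Fin (m + 1)) :
    ‖y j - y k‖ ≤ 2 * halfMax y j := by
  have := Finset.le_sup' (fun k => ‖y j - y k‖) (Finset.mem_univ k)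
  unfold halfMax
  linarith

lemma halfMax_le (y : Fin (m + 1) → E n) (j : Fin (m + 1)) : halfMax y j ≤ ‖diffs y‖ := by
  have := Finset.sup'_le Finset.univ_nonempty (fun k => ‖y j - y k‖)
    fun k _ => norm_sub_le_two_mul y j k
  unfold halfMax
  linarith

lemma norm_diffs_le_halfMax (y : Fin (m + 1) → E n) (j : Fin (m + 1)) :
    ‖diffs y‖ ≤ 4 * halfMax y j := by
  have h0 : 0 ≤ halfMax y j := by
    have := norm_sub_le_halfMax y j j
    simp at this
    exact this
  refine (pi_norm_le_iff_of_nonneg (by positivity)).2 fun k => ?_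
  have h1 := norm_sub_le_halfMax y j 0
  have h2 := norm_sub_le_halfMax y j k.succ
  have h3 := norm_sub_le (y j - y k.succ) (y j - y 0)
  rw [sub_sub_sub_cancel_left] at h3
  exact h3.trans (by linarith)

lemma norm_update_sub_le (y : Fin (m + 1) → E n) (j k : Fin (m + 1)) (u : E n) :
    ‖y k - Function.update y j u k‖ ≤ ‖y j - u‖ := by
  rcases eq_or_ne k j with rfl | h
  · simp
  · simp [Function.update_of_ne h]

lemma norm_diffs_sub_update_le (y : Fin (m + 1) → E n) (j : Fin (m + 1)) (u : E n) :
    ‖diffs y - diffs (Function.update y j u)‖ ≤ ‖y j - u‖ := by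
  refine (pi_norm_le_iff_of_nonneg (norm_nonneg _)).2 fun k => ?_
  simp only [Pi.sub_apply, diffs]
  rcases eq_or_ne j 0 with rfl | h
  · simp
  · rw [Function.update_of_ne h.symm, sub_sub_sub_cancel_left, norm_sub_rev]
    exact norm_update_sub_le y j k.succ u

/-- Some `y k` is at distance `2 * halfMax y j` from `y j`. It is not moved, so the new point `u`
remains at distance at least `halfMax y j` from it; in particular the perturbed tuple stays off the
diagonal. -/
lemma halfMax_le_diffs_update {y : Fin (m + 1) → E n} {j : Fin (m + 1)} {u : E n}
    (h : ‖y j - u‖ ≤ halfMax y j) (hpos : 0 < halfMax y j) :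
    halfMax y j ≤ 2 * ‖diffs (Function.update y j u)‖ := by
  obtain ⟨k, -, hk⟩ := Finset.exists_mem_eq_sup' Finset.univ_nonempty (fun k => ‖y j - y k‖)
  have hk2 : 2 * halfMax y j = ‖y j - y k‖ := by rw [← hk]; unfold halfMax; ring
  have hne : k ≠ j := by
    rintro rfl
    rw [sub_self, norm_zero] at hk2
    linarith
  have h1 := norm_sub_le_two_mul (Function.update y j u) j k
  rw [Function.update_self, Function.update_of_ne hne] at h1
  have h2 := norm_add_le (y j - u) (u - y k)
  rw [sub_add_sub_cancel] at h2
  linarith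

lemma inv_pow_le_of_spread {y : Fin (m + 1) → E n} (hy : OffDiag y) {N : ℝ} (hN : 0 ≤ N) :
    1 / ‖diffs y‖ ^ N ≤ (2 * (m + 1) ^ 2) ^ N / spread y ^ N := by
  have h0 : 0 < ‖diffs y‖ := norm_pos_iff.2 hy.diffs_ne_zero
  have hs : 0 < spread y := h0.trans_le (norm_diffs_le_spread y)
  rw [div_le_div_iff₀ (by positivity) (by positivity), one_mul, ← Real.mul_rpow (by positivity)
    (by positivity)]
  exact Real.rpow_le_rpow hs.le (spread_le y) hN

/-! ### Decay and smoothness of the kernel -/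

variable [NeZero m] [NeZero n] {δ : ℝ} {a : Phase m n → ℂ}

/-- The kernel of the operator with symbol `a`. -/
def opKernel (a : Phase m n → ℂ) (y : Fin (m + 1) → E n) : ℂ :=
  symbolKernel (fun ξ => a (y 0, ξ)) (diffs y)

lemma IsSymbol.integrable_fwdDiff (ha : IsSymbol 0 1 δ a) (x : E n) (z : Fin m → E n) :
    Integrable ((fwdDiff (domVec z))^[m * n + 2] fun ξ => a (x, ξ)) := by
  obtain ⟨A, -, h⟩ := ha.diffBound (M := m * n + 2) (by omega)
  exact (h x).integrable (ha.continuous_section x) (by omega) _ _ _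

lemma IsSymbol.norm_symbolKernel_le (ha : IsSymbol 0 1 δ a) {N : ℕ} (hN : m * n ≤ N) :
    ∃ C : ℝ, 0 ≤ C ∧ ∀ x z, z ≠ 0 → ‖symbolKernel (fun ξ => a (x, ξ)) z‖ ≤ C / ‖z‖ ^ N := by
  obtain ⟨A, hA, hb⟩ := ha.diffBound (M := N + 1) (by omega)
  obtain ⟨C, hC, h⟩ := MultPsiDO.norm_symbolKernel_le (m := m) (n := n) (N := N) (l := 0) (by omega)
  exact ⟨C * A, by positivity, fun x z hz => h _ A z (ha.continuous_section x) hA hz (hb x)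
    (ha.integrable_fwdDiff x z)⟩

lemma symbolKernel_sub {b b' : (Fin m → E n) → ℂ} {z : Fin m → E n}
    (h : Integrable ((fwdDiff (domVec z))^[m * n + 2] b))
    (h' : Integrable ((fwdDiff (domVec z))^[m * n + 2] b')) :
    symbolKernel (b - b') z = symbolKernel b z - symbolKernel b' z := by
  unfold symbolKernel
  rw [fwdDiff_iter_sub, ← mul_sub,
    ← integral_sub (integrable_mul_phase h z) (integrable_mul_phase h' z)]
  simp only [Pi.sub_apply, sub_mul]

/-- The intermediate value is the kernel of `a(x, ·)` at `z'`: first `z` varies with `x` frozen,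
then the symbol varies at `z'`. One `r` controls both increments since moving `y₀` changes `x` and
`z` together. -/
lemma IsSymbol.norm_symbolKernel_sub_le (hδ : δ ≤ 1) (ha : IsSymbol 0 1 δ a) {N : ℕ}
    (hN : m * n ≤ N) {κ : ℝ} (hκ : 0 ≤ κ) : ∃ C : ℝ, 0 ≤ C ∧
      ∀ x x' z z' r, z ≠ 0 → z' ≠ 0 → ‖z‖ ≤ κ * ‖z'‖ → ‖x - x'‖ ≤ r → ‖z - z'‖ ≤ r →
        ‖symbolKernel (fun ξ => a (x, ξ)) z - symbolKernel (fun ξ => a (x', ξ)) z'‖ ≤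
          C * r / ‖z‖ ^ (N + 1) := by
  obtain ⟨A₁, hA₁, h₁⟩ := ha.diffBound (M := N + 1) (by omega)
  obtain ⟨A₂, hA₂, h₂⟩ := ha.diffBound (M := N + 2) (by omega)
  obtain ⟨A₃, hA₃, h₃⟩ := ha.diffBound (M := m * n + 2) (by omega)
  obtain ⟨A₄, hA₄, h₄⟩ := ha.diffBound_sub hδ (M := N + 1 + 1) (by omega)
  have mono : ∀ {M : ℕ} {A A' : ℝ} {b : (Fin m → E n) → ℂ}, A ≤ A' → DiffBound M A 0 b →
      DiffBound M A' 0 b := fun hAA hb j i τ ξ => (hb j i τ ξ).trans (by gcongr)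
  obtain ⟨C₁, hC₁, hK₁⟩ := MultPsiDO.norm_symbolKernel_sub_le (m := m) (n := n) hN hκ
  obtain ⟨C₂, hC₂, hK₂⟩ := MultPsiDO.norm_symbolKernel_le (m := m) (n := n) (N := N + 1) (l := 1)
    (by omega)
  refine ⟨C₁ * (A₁ + A₂ + A₃) + C₂ * A₄ * κ ^ (N + 1), by positivity, ?_⟩
  intro x x' z z' r hz hz' hzz hx hzr
  have hz0 : 0 < ‖z‖ := norm_pos_iff.2 hz
  have hz0' : 0 < ‖z'‖ := norm_pos_iff.2 hz'
  have e1 := hK₁ (fun ξ => a (x, ξ)) (A₁ + A₂ + A₃) z z' (ha.continuous_section x) (by positivity)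
    hz hz' hzz (mono (by linarith) (h₁ x)) (mono (by linarith) (h₂ x)) (mono (by linarith) (h₃ x))
  have hsub := symbolKernel_sub (ha.integrable_fwdDiff x z') (ha.integrable_fwdDiff x' z')
  have e2 := hK₂ ((fun ξ => a (x, ξ)) - fun ξ => a (x', ξ)) (A₄ * ‖x - x'‖) z'
    ((ha.continuous_section x).sub (ha.continuous_section x')) (by positivity) hz' (h₄ x x')
    (by rw [fwdDiff_iter_sub]
        exact (ha.integrable_fwdDiff x z').sub (ha.integrable_fwdDiff x' z'))
  rw [hsub] at e2
  have e3 : C₂ * (A₄ * ‖x - x'‖) / ‖z'‖ ^ (N + 1) ≤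
      C₂ * A₄ * κ ^ (N + 1) * r / ‖z‖ ^ (N + 1) := by
    rw [div_le_div_iff₀ (by positivity) (by positivity)]
    have : ‖z‖ ^ (N + 1) ≤ κ ^ (N + 1) * ‖z'‖ ^ (N + 1) := by rw [← mul_pow]; gcongr
    calc C₂ * (A₄ * ‖x - x'‖) * ‖z‖ ^ (N + 1)
        ≤ C₂ * (A₄ * r) * (κ ^ (N + 1) * ‖z'‖ ^ (N + 1)) := by
          have : 0 ≤ r := (norm_nonneg _).trans hx
          gcongr
      _ = _ := by ring
  have e4 : C₁ * (A₁ + A₂ + A₃) * ‖z - z'‖ / ‖z‖ ^ (N + 1) ≤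
      C₁ * (A₁ + A₂ + A₃) * r / ‖z‖ ^ (N + 1) := by gcongr
  calc _ ≤ _ := norm_sub_le_norm_sub_add_norm_sub _ (symbolKernel (fun ξ => a (x, ξ)) z') _
    _ ≤ _ := add_le_add (e1.trans e4) (e2.trans e3)
    _ = _ := by ring

theorem IsSymbol.decayCondition (ha : IsSymbol 0 1 δ a) : DecayCondition (opKernel a) := by
  intro N hN
  have hN0 : 0 ≤ N := le_trans (by positivity) hN
  -- A real exponent is reached by rounding: down for `‖diffs y‖ ≤ 1`, up for `‖diffs y‖ ≥ 1`.
  -- Rounding down keeps the exponent at least `m * n`, which is an integer.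
  obtain ⟨C₁, hC₁, h₁⟩ := ha.norm_symbolKernel_le (N := ⌊N⌋₊)
    (Nat.le_floor (by exact_mod_cast hN))
  obtain ⟨C₂, hC₂, h₂⟩ := ha.norm_symbolKernel_le (N := ⌈N⌉₊)
    (by exact_mod_cast hN.trans (Nat.le_ceil N))
  refine ⟨(C₁ + C₂ + 1) * (2 * (m + 1) ^ 2) ^ N, by positivity, fun y hy => ?_⟩
  have h0 : 0 < ‖diffs y‖ := norm_pos_iff.2 hy.diffs_ne_zero
  have key : ‖opKernel a y‖ ≤ (C₁ + C₂ + 1) * (1 / ‖diffs y‖ ^ N) := by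
    rw [mul_one_div]
    rcases le_total ‖diffs y‖ 1 with h | h
    · refine (h₁ (y 0) _ hy.diffs_ne_zero).trans ?_
      have : ‖diffs y‖ ^ N ≤ ‖diffs y‖ ^ ⌊N⌋₊ := by
        rw [← Real.rpow_natCast]
        exact Real.rpow_le_rpow_of_exponent_ge h0 h (Nat.floor_le hN0)
      exact div_le_div₀ (by positivity) (by linarith) (by positivity) this
    · refine (h₂ (y 0) _ hy.diffs_ne_zero).trans ?_
      have : ‖diffs y‖ ^ N ≤ ‖diffs y‖ ^ ⌈N⌉₊ := by
        rw [← Real.rpow_natCast]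
        exact Real.rpow_le_rpow_of_exponent_le h (Nat.le_ceil N)
      exact div_le_div₀ (by positivity) (by linarith) (by positivity) this
  rw [mul_div_assoc]
  exact key.trans (mul_le_mul_of_nonneg_left (inv_pow_le_of_spread hy hN0) (by positivity))

theorem IsSymbol.smoothnessCondition (hδ : δ ≤ 1) (ha : IsSymbol 0 1 δ a) :
    SmoothnessCondition (opKernel a) := by
  refine ⟨1, one_pos, fun N hN => ?_⟩
  -- The critical exponent serves `halfMax ≤ 1`, the larger one below gives the extra decay for
  -- `halfMax ≥ 1`. The ratio `8` is `4 * 2`, from `norm_diffs_le_halfMax` and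
  -- `halfMax_le_diffs_update`.
  obtain ⟨C₁, hC₁, h₁⟩ := ha.norm_symbolKernel_sub_le hδ (N := m * n) le_rfl
    (by norm_num : (0 : ℝ) ≤ 8)
  obtain ⟨C₂, hC₂, h₂⟩ := ha.norm_symbolKernel_sub_le hδ (N := m * n + ⌈N⌉₊) (by omega)
    (by norm_num : (0 : ℝ) ≤ 8)
  refine ⟨(C₁ + C₂ + 1) * (2 * (m + 1) ^ 2) ^ ((m : ℝ) * n + 1), by positivity,
    fun j y u hy hu => ?_⟩
  have h0 : 0 < ‖diffs y‖ := norm_pos_iff.2 hy.diffs_ne_zero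
  have hh : 0 < halfMax y j := by linarith [norm_diffs_le_halfMax y j]
  have hup := halfMax_le_diffs_update hu hh
  have hz' : 0 < ‖diffs (Function.update y j u)‖ := by linarith
  have hzz : ‖diffs y‖ ≤ 8 * ‖diffs (Function.update y j u)‖ := by
    linarith [norm_diffs_le_halfMax y j]
  have hexp : ‖diffs y‖ ^ ((m : ℝ) * n + 1) = ‖diffs y‖ ^ (m * n + 1) := by
    rw [← Real.rpow_natCast]; push_cast; rfl
  have key : ‖opKernel a y - opKernel a (Function.update y j u)‖ ≤
      (C₁ + C₂ + 1) * ‖y j - u‖ * (1 / ‖diffs y‖ ^ ((m : ℝ) * n + 1)) *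
        min 1 (halfMax y j ^ (-N)) := by
    rw [hexp]
    rcases le_total (halfMax y j) 1 with h | h
    · rw [min_eq_left (Real.one_le_rpow_of_pos_of_le_one_of_nonpos hh h (by linarith)), mul_one,
        mul_one_div]
      refine (h₁ _ _ _ _ ‖y j - u‖ hy.diffs_ne_zero (norm_pos_iff.1 hz') hzz
        (norm_update_sub_le y j 0 u) (norm_diffs_sub_update_le y j u)).trans ?_
      gcongr
      linarith
    · rw [min_eq_right (Real.rpow_le_one_of_one_le_of_nonpos h (by linarith))]
      refine (h₂ _ _ _ _ ‖y j - u‖ hy.diffs_ne_zero (norm_pos_iff.1 hz') hzz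
        (norm_update_sub_le y j 0 u) (norm_diffs_sub_update_le y j u)).trans ?_
      have e1 : halfMax y j ^ N ≤ ‖diffs y‖ ^ ⌈N⌉₊ := by
        refine (Real.rpow_le_rpow_of_exponent_le h (Nat.le_ceil N)).trans ?_
        rw [Real.rpow_natCast]
        exact pow_le_pow_left₀ hh.le (halfMax_le y j) _
      rw [Real.rpow_neg hh.le, mul_assoc, ← one_div, div_mul_div_comm, one_mul, mul_one_div,
        show m * n + ⌈N⌉₊ + 1 = (m * n + 1) + ⌈N⌉₊ by ring, pow_add]
      gcongr
      linarith
  refine key.trans (le_of_le_of_eq (mul_le_mul_of_nonneg_right (mul_le_mul_of_nonneg_left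
    (inv_pow_le_of_spread hy (by positivity)) (by positivity)) (by positivity)) ?_)
  rw [Real.rpow_one]
  ring

end

/-! ### Cutoff functions -/

lemma exists_norm_iteratedFDeriv_le {V : Type*} [NormedAddCommGroup V] [NormedSpace ℝ V]
    {g : V → ℂ} (hg : ContDiff ℝ ∞ g) (hs : HasCompactSupport g) (k : ℕ) :
    ∃ B : ℝ, 0 ≤ B ∧ ∀ ξ, ‖iteratedFDeriv ℝ k g ξ‖ ≤ B := by
  obtain ⟨B, hB⟩ := (hg.continuous_iteratedFDeriv (m := k) (by exact_mod_cast le_top)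
    ).bounded_above_of_compact_support (hs.iteratedFDeriv (𝕜 := ℝ) k)
  exact ⟨B, (norm_nonneg _).trans (hB 0), hB⟩

lemma hasDerivAt_iteratedFDeriv_smul {V : Type*} [NormedAddCommGroup V] [NormedSpace ℝ V]
    {g : V → ℂ} (hg : ContDiff ℝ ∞ g) (ε : ℝ) (k : ℕ) (ξ v : V) (t : ℝ) :
    HasDerivAt (fun r : ℝ => (ε : ℂ) ^ k * iteratedFDeriv ℝ k g (ε • (ξ + r • v)) fun _ => v)
      ((ε : ℂ) ^ (k + 1) * iteratedFDeriv ℝ (k + 1) g (ε • (ξ + t • v)) fun _ => v) t := by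
  have h1 : HasDerivAt (fun r : ℝ => ε • (ξ + r • v)) (ε • v) t := by
    have h0 : HasDerivAt (fun r : ℝ => ξ + r • v) v t := by
      simpa using ((hasDerivAt_id t).smul_const v).const_add ξ
    exact h0.const_smul ε
  have h2 := ((hg.differentiable_iteratedFDeriv (m := k) (by exact_mod_cast WithTop.coe_lt_top k))
    (ε • (ξ + t • v))).hasFDerivAt
  have h3 := h2.comp_hasDerivAt t h1
  have h4 := (ContinuousMultilinearMap.apply ℝ (fun _ : Fin k => V) ℂ
    (fun _ => v)).hasFDerivAt.comp_hasDerivAt t h3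
  have h5 := h4.const_mul ((ε : ℂ) ^ k)
  refine h5.congr_deriv ?_
  rw [iteratedFDeriv_succ_apply_left, map_smul, map_smul, pow_succ, mul_assoc]
  congr 1

/-- Each derivative produces a factor `ε`, and on the support `ε * (1 + ‖ξ‖) ≤ 3`, so `ε` pays for
the decay with constants independent of `ε`. -/
lemma symbolBound_comp_smul {m n : ℕ} {g : (Fin m → E n) → ℂ} (hg : ContDiff ℝ ∞ g)
    (hs : tsupport g ⊆ Metric.closedBall 0 2) (M : ℕ) : ∃ B : ℝ, 0 ≤ B ∧
      ∀ ε : ℝ, 0 ≤ ε → ε ≤ 1 → SymbolBound M B 0 fun ξ => g (ε • ξ) := by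
  have hc : HasCompactSupport g :=
    (isCompact_closedBall (0 : Fin m → E n) 2).of_isClosed_subset (isClosed_tsupport g) hs
  choose B hB0 hB using exists_norm_iteratedFDeriv_le hg hc
  refine ⟨∑ k ∈ Finset.range (M + 1), B k * 3 ^ k,
    Finset.sum_nonneg fun k _ => mul_nonneg (hB0 k) (by positivity), fun ε hε0 hε1 j i =>
    ⟨fun k ξ => (ε : ℂ) ^ k * iteratedFDeriv ℝ k g (ε • ξ) fun _ => coordVec j i, ?_,
      fun k ξ t => hasDerivAt_iteratedFDeriv_smul hg ε k ξ _ t, fun k hk ξ => ?_⟩⟩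
  · ext ξ; simp
  · have h1 : B k * 3 ^ k ≤ ∑ k ∈ Finset.range (M + 1), B k * 3 ^ k :=
      Finset.single_le_sum (f := fun k => B k * 3 ^ k)
        (fun k _ => mul_nonneg (hB0 k) (by positivity)) (Finset.mem_range.2 (Nat.lt_succ_of_le hk))
    rw [pow_zero, mul_one]
    refine le_trans ?_ (div_le_div_of_nonneg_right h1 (by positivity))
    by_cases h0 : iteratedFDeriv ℝ k g (ε • ξ) = 0
    · simp only [h0, zero_apply, mul_zero, norm_zero]
      have := hB0 k
      positivity
    · have h2 : ε • ξ ∈ Metric.closedBall (0 : Fin m → E n) 2 :=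
        hs (tsupport_iteratedFDeriv_subset k (subset_tsupport _ h0))
      rw [mem_closedBall_zero_iff, norm_smul, Real.norm_of_nonneg hε0] at h2
      rw [le_div_iff₀ (by positivity), norm_mul, norm_pow, Complex.norm_real,
        Real.norm_of_nonneg hε0]
      have h3 : ‖iteratedFDeriv ℝ k g (ε • ξ) fun _ => coordVec j i‖ ≤ B k := by
        refine ((iteratedFDeriv ℝ k g (ε • ξ)).le_opNorm _).trans ?_
        simpa [norm_coordVec] using hB k (ε • ξ)
      have h4 : (ε * (1 + ‖ξ‖)) ^ k ≤ 3 ^ k := by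
        gcongr
        linarith
      rw [mul_pow] at h4
      calc ε ^ k * ‖iteratedFDeriv ℝ k g (ε • ξ) fun _ => coordVec j i‖ * (1 + ‖ξ‖) ^ k
          ≤ ε ^ k * B k * (1 + ‖ξ‖) ^ k := by gcongr
        _ = B k * (ε ^ k * (1 + ‖ξ‖) ^ k) := by ring
        _ ≤ B k * 3 ^ k := mul_le_mul_of_nonneg_left h4 (hB0 k)

lemma exists_cutoff (m n : ℕ) : ∃ χ : ℕ → (Fin m → E n) → ℂ, (∀ k, Continuous (χ k)) ∧
    (∀ k, HasCompactSupport (χ k)) ∧ (∀ k ξ, ‖χ k ξ‖ ≤ 1) ∧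
    (∀ ξ, Tendsto (fun k => χ k ξ) atTop (𝓝 1)) ∧
    ∀ M, ∃ B : ℝ, 0 ≤ B ∧ ∀ k, SymbolBound M B 0 (χ k) := by
  let φ : ContDiffBump (0 : Fin m → E n) := ⟨1, 2, one_pos, one_lt_two⟩
  let g : (Fin m → E n) → ℂ := fun ξ => (φ ξ : ℂ)
  have hg : ContDiff ℝ ∞ g := Complex.ofRealCLM.contDiff.comp φ.contDiff
  have hs : tsupport g ⊆ Metric.closedBall 0 2 := by
    have : Function.support g ⊆ Metric.closedBall 0 2 := fun ξ hξ => by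
      have h1 : ξ ∈ Function.support φ := fun h => hξ (by simp [g, h])
      rw [φ.support_eq] at h1
      exact Metric.ball_subset_closedBall h1
    exact closure_minimal this Metric.isClosed_closedBall
  have hc : HasCompactSupport g :=
    (isCompact_closedBall (0 : Fin m → E n) 2).of_isClosed_subset (isClosed_tsupport g) hs
  have hε : ∀ k : ℕ, (0 : ℝ) < 1 / ((k : ℝ) + 1) := fun k => by positivity
  refine ⟨fun k ξ => g ((1 / ((k : ℝ) + 1)) • ξ), fun k => ?_, fun k => ?_, fun k ξ => ?_,
    fun ξ => ?_, fun M => ?_⟩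
  · exact hg.continuous.comp (continuous_const_smul _)
  · exact hc.comp_smul (hε k).ne'
  · simp only [g, Complex.norm_real, Real.norm_of_nonneg φ.nonneg]
    exact φ.le_one
  · have h1 : Tendsto (fun k : ℕ => (1 / ((k : ℝ) + 1)) • ξ) atTop (𝓝 ((0 : ℝ) • ξ)) :=
      tendsto_one_div_add_atTop_nhds_zero_nat.smul_const ξ
    rw [zero_smul] at h1
    have h2 := (hg.continuous.tendsto 0).comp h1
    have h3 : g 0 = 1 := by
      have : φ 0 = 1 := φ.one_of_mem_closedBall (by simp [φ])
      simp [g, this]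
    rw [h3] at h2
    exact h2
  · obtain ⟨B, hB0, hB⟩ := symbolBound_comp_smul hg hs M
    refine ⟨B, hB0, fun k => hB _ (hε k).le ?_⟩
    rw [div_le_one (by positivity)]
    have : (0 : ℝ) ≤ k := Nat.cast_nonneg k
    linarith

/-! ### The operator as an oscillatory integral -/

lemma integrable_hat {n : ℕ} (f : 𝓢(E n, ℂ)) : Integrable (hat f) := by
  have h1 : Integrable (𝓕 (f : E n → ℂ)) := by
    rw [← SchwartzMap.fourier_coe]
    exact (𝓕 f).integrable
  have h2 := h1.comp_smul (R := (2 * Real.pi)⁻¹) (by positivity)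
  refine h2.congr (Eventually.of_forall fun ξ => ?_)
  simp only [Real.fourier_eq', hat]
  congr 1
  ext y
  rw [smul_eq_mul, mul_comm]
  congr 2
  rw [inner_smul_right]
  have : -2 * Real.pi * ((2 * Real.pi)⁻¹ * inner ℝ y ξ) = -inner ℝ y ξ := by
    field_simp
  rw [this]
  push_cast
  ring

section

variable {m n : ℕ}

lemma prod_hat_mul_exp_eq (f : Fin m → 𝓢(E n, ℂ)) (x : E n) (ξ : Fin m → E n) :
    (∏ j, hat (f j) (ξ j)) * Complex.exp (Complex.I * ((inner ℝ x (∑ j, ξ j) : ℝ) : ℂ)) =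
      ∫ y : Fin m → E n, (∏ j, f j (y j)) * phase (fun j => x - y j) ξ := by
  unfold hat
  rw [← integral_fintype_prod_volume_eq_prod
    (fun j (y : E n) => f j y * Complex.exp (-Complex.I * ((inner ℝ y (ξ j) : ℝ) : ℂ))),
    ← integral_mul_const]
  congr 1
  ext y
  rw [Finset.prod_mul_distrib, mul_assoc]
  congr 1
  rw [← Complex.exp_sum, ← Complex.exp_add, phase, ← Finset.mul_sum]
  congr 1
  simp only [inner_sub_left, Finset.sum_sub_distrib, inner_sum, Complex.ofReal_sub,
    Complex.ofReal_sum]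
  ring

lemma integrable_prod_schwartz (f : Fin m → 𝓢(E n, ℂ)) :
    Integrable fun y : Fin m → E n => ∏ j, f j (y j) :=
  Integrable.fintype_prod (f := fun j => (f j : E n → ℂ)) fun j => (f j).integrable

lemma integrable_prod_hat_mul_exp (f : Fin m → 𝓢(E n, ℂ)) (x : E n) :
    Integrable fun ξ : Fin m → E n => (∏ j, hat (f j) (ξ j)) *
      Complex.exp (Complex.I * ((inner ℝ x (∑ j, ξ j) : ℝ) : ℂ)) := by
  have h : Integrable fun ξ : Fin m → E n => ∏ j, hat (f j) (ξ j) :=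
    Integrable.fintype_prod (f := fun j => hat (f j)) fun j => integrable_hat (f j)
  refine h.mul_bdd (c := 1) (Continuous.aestronglyMeasurable (by fun_prop))
    (Eventually.of_forall fun ξ => (Complex.norm_exp_I_mul_ofReal _).le)

lemma integrable_kernel_prod {b : (Fin m → E n) → ℂ} (hb : Integrable b)
    (f : Fin m → 𝓢(E n, ℂ)) (x : E n) :
    Integrable (Function.uncurry fun (ξ y : Fin m → E n) =>
      b ξ * ((∏ j, f j (y j)) * phase (fun j => x - y j) ξ)) (volume.prod volume) := by
  have h1 := (hb.mul_prod (integrable_prod_schwartz f)).mul_bdd (c := 1)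
    (g := fun p : (Fin m → E n) × (Fin m → E n) => phase (fun j => x - p.2 j) p.1)
    (Continuous.aestronglyMeasurable (by unfold phase; fun_prop))
    (Eventually.of_forall fun p => (norm_phase _ _).le)
  refine h1.congr (Eventually.of_forall fun p => ?_)
  simp only [Function.uncurry]
  ring

lemma integral_mul_prod_hat_eq {b : (Fin m → E n) → ℂ} (hb : Integrable b)
    (f : Fin m → 𝓢(E n, ℂ)) (x : E n) :
    ∫ ξ : Fin m → E n, b ξ * ((∏ j, hat (f j) (ξ j)) *
      Complex.exp (Complex.I * ((inner ℝ x (∑ j, ξ j) : ℝ) : ℂ))) =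
    ∫ y : Fin m → E n, (∫ ξ, b ξ * phase (fun j => x - y j) ξ) * ∏ j, f j (y j) := by
  simp only [prod_hat_mul_exp_eq, ← integral_const_mul]
  rw [integral_integral_swap (integrable_kernel_prod hb f x)]
  congr 1
  ext y
  rw [← integral_mul_const]
  congr 1
  ext ξ
  ring

lemma tendsto_fwdDiff_iter {V : Type*} [AddCommGroup V] {f : ℕ → V → ℂ} {g : V → ℂ}
    (h : ∀ ξ, Tendsto (fun k => f k ξ) atTop (𝓝 (g ξ))) (v : V) (M : ℕ) (ξ : V) :
    Tendsto (fun k => (fwdDiff v)^[M] (f k) ξ) atTop (𝓝 ((fwdDiff v)^[M] g ξ)) := by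
  induction M generalizing f g with
  | zero => exact h ξ
  | succ M ih =>
    simp only [Function.iterate_succ_apply]
    exact ih fun η => (h (η + v)).sub (h η)

lemma diffs_cons (x : E n) (y : Fin m → E n) : diffs (Fin.cons x y) = fun j => x - y j := by
  ext j; simp [diffs]

variable [NeZero m] [NeZero n]

/-- Dominated convergence applies to the differenced symbols, whose uniform bound is integrable,
although the symbols themselves need not have an integrable majorant. -/
lemma tendsto_symbolKernel {f : ℕ → (Fin m → E n) → ℂ} {b : (Fin m → E n) → ℂ} {A : ℝ}
    (hf : ∀ k, Continuous (f k)) (h : ∀ ξ, Tendsto (fun k => f k ξ) atTop (𝓝 (b ξ)))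
    (hA : ∀ k, DiffBound (m * n + 2) A 0 (f k)) (z : Fin m → E n) :
    Tendsto (fun k => symbolKernel (f k) z) atTop (𝓝 (symbolKernel b z)) := by
  unfold symbolKernel
  refine Tendsto.const_mul _ ?_
  have hw := (integrable_weight (m := m) (n := n) (T := |domStep z|) (P := max 1 |domStep z|)
    (N := m * n + 2) (l := 0) (by positivity) (by omega)).const_mul A
  refine tendsto_integral_of_dominated_convergence _ (fun k => ?_) hw
    (fun k => Eventually.of_forall fun ξ => ?_) (Eventually.of_forall fun ξ => ?_)
  · exact ((continuous_fwdDiff_iter _ _ (hf k)).mul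
      (continuous_phase_right z)).aestronglyMeasurable
  · rw [norm_mul, norm_phase, mul_one, ← mul_assoc]
    exact hA k _ _ _ _
  · exact (tendsto_fwdDiff_iter h _ _ ξ).mul_const _

theorem IsSymbol.isAssociatedKernel {δ : ℝ} {a : Phase m n → ℂ} (ha : IsSymbol 0 1 δ a) :
    IsAssociatedKernel (psiDO a) (opKernel a) := by
  intro f x hx
  obtain ⟨j₀, hj₀⟩ : ∃ j, x ∉ tsupport (f j) := by simpa using hx
  obtain ⟨r, hr, hball⟩ := Metric.isOpen_iff.1 (isClosed_tsupport (f j₀)).isOpen_compl x hj₀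
  have hfar : ∀ y : Fin m → E n, ∏ j, f j (y j) ≠ 0 → r ≤ ‖fun j => x - y j‖ := by
    intro y hy
    have h1 : f j₀ (y j₀) ≠ 0 := fun h => hy (Finset.prod_eq_zero (Finset.mem_univ j₀) h)
    by_contra hlt
    have h2 : ‖x - y j₀‖ < r := (norm_le_pi_norm (fun j => x - y j) j₀).trans_lt (not_le.1 hlt)
    have h3 : y j₀ ∈ Metric.ball x r := by
      rwa [Metric.mem_ball, dist_comm, dist_eq_norm]
    exact hball h3 (subset_tsupport _ h1)
  set b : (Fin m → E n) → ℂ := fun ξ => a (x, ξ) with hb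
  have hbc : Continuous b := ha.continuous_section x
  obtain ⟨χ, hχc, hχs, hχ1, hχt, hχb⟩ := exists_cutoff m n
  have hreg : ∀ M, 1 ≤ M → ∃ A : ℝ, 0 ≤ A ∧ ∀ k, DiffBound M A 0 fun ξ => b ξ * χ k ξ := by
    intro M hM
    obtain ⟨A, hA, h1⟩ := ha.symbolBound M
    obtain ⟨B, hB, h2⟩ := hχb M
    exact ⟨_, by positivity, fun k => (h1 x).diffBound_mul hM hA hB (h2 k)⟩
  have hcont : ∀ k, Continuous fun ξ => b ξ * χ k ξ := fun k => hbc.mul (hχc k)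
  have hint : ∀ k, Integrable fun ξ => b ξ * χ k ξ := fun k =>
    (hcont k).integrable_of_hasCompactSupport (hχs k).mul_left
  have hlim : ∀ ξ, Tendsto (fun k => b ξ * χ k ξ) atTop (𝓝 (b ξ)) := fun ξ => by
    simpa using (hχt ξ).const_mul (b ξ)
  have hker : ∀ k (z : Fin m → E n), z ≠ 0 →
      ∫ ξ, b ξ * χ k ξ * phase z ξ = symbolKernel (fun ξ => b ξ * χ k ξ) z := by
    intro k z hz
    -- With no differences at all: for an integrable symbol the kernel is the plain Fourier
    -- integral.
    simpa using integral_fwdDiff_mul_phase_eq (M := 0) (v := 0) hz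
      (integrable_fwdDiff_iter (hint k) _ _) (hint k)
  obtain ⟨A₁, hA₁, hD₁⟩ := hreg (m * n + 1) (by omega)
  obtain ⟨A₂, hA₂, hD₂⟩ := hreg (m * n + 2) (by omega)
  obtain ⟨C, hC, hCb⟩ := MultPsiDO.norm_symbolKernel_le (m := m) (n := n) (N := m * n) (l := 0) (by omega)
  have hne : ∀ y : Fin m → E n, ∏ j, f j (y j) ≠ 0 → (fun j => x - y j) ≠ 0 := fun y hy h => by
    have := hfar y hy
    rw [h, norm_zero] at this
    linarith
  have hbound : ∀ k (y : Fin m → E n),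
      ‖(∫ ξ, b ξ * χ k ξ * phase (fun j => x - y j) ξ) * ∏ j, f j (y j)‖ ≤
        C * A₁ / r ^ (m * n) * ‖∏ j, f j (y j)‖ := by
    intro k y
    rw [norm_mul]
    by_cases hy : ∏ j, f j (y j) = 0
    · simp [hy]
    · refine mul_le_mul_of_nonneg_right ?_ (norm_nonneg _)
      rw [hker k _ (hne y hy)]
      refine (hCb _ A₁ _ (hcont k) hA₁ (hne y hy) (hD₁ k)
        (integrable_fwdDiff_iter (hint k) _ _)).trans ?_
      have := hfar y hy
      gcongr
  have hptw : ∀ y : Fin m → E n, Tendsto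
      (fun k => (∫ ξ, b ξ * χ k ξ * phase (fun j => x - y j) ξ) * ∏ j, f j (y j)) atTop
      (𝓝 (opKernel a (Fin.cons x y) * ∏ j, f j (y j))) := by
    intro y
    by_cases hy : ∏ j, f j (y j) = 0
    · simp [hy]
    · refine Tendsto.mul_const _ ?_
      simp only [hker _ _ (hne y hy)]
      have h1 := tendsto_symbolKernel hcont hlim hD₂ fun j => x - y j
      rw [opKernel, diffs_cons]
      exact h1
  have hmeas : ∀ k, AEStronglyMeasurable (fun y : Fin m → E n =>
      (∫ ξ, b ξ * χ k ξ * phase (fun j => x - y j) ξ) * ∏ j, f j (y j)) volume := by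
    intro k
    refine ((integrable_kernel_prod (hint k) f x).integral_prod_right.congr
      (Eventually.of_forall fun y => ?_)).aestronglyMeasurable
    simp only [Function.uncurry]
    rw [← integral_mul_const]
    congr 1
    ext ξ
    ring
  have hFint := ((integrable_prod_schwartz f).norm.const_mul (C * A₁ / r ^ (m * n)))
  -- The step `domVec` is an arbitrary choice for each `z`, so measurability in `y` is read off from
  -- the limit of the regularized kernels rather than from the definition.
  refine ⟨hFint.mono' (aestronglyMeasurable_of_tendsto_ae atTop hmeas
    (Eventually.of_forall hptw)) (Eventually.of_forall fun y =>
      le_of_tendsto (hptw y).norm (Eventually.of_forall fun k => hbound k y)), ?_⟩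
  have hright := tendsto_integral_of_dominated_convergence _ hmeas hFint
    (fun k => Eventually.of_forall (hbound k)) (Eventually.of_forall hptw)
  -- Order zero only: boundedness of the symbol, which gives the majorant on the frequency side.
  obtain ⟨A, hA, hAb⟩ := ha.symbolBound 0
  have hbA : ∀ ξ, ‖b ξ‖ ≤ A := by
    intro ξ
    obtain ⟨D, hD, -, hDb⟩ := hAb x ⟨0, Nat.pos_of_ne_zero (NeZero.ne m)⟩
      ⟨0, Nat.pos_of_ne_zero (NeZero.ne n)⟩
    simpa [hD] using hDb 0 le_rfl ξ
  have hΦ := integrable_prod_hat_mul_exp f x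
  have hleft : Tendsto (fun k => ∫ ξ : Fin m → E n, b ξ * χ k ξ * ((∏ j, hat (f j) (ξ j)) *
      Complex.exp (Complex.I * ((inner ℝ x (∑ j, ξ j) : ℝ) : ℂ)))) atTop (𝓝 (psiDO a f x)) := by
    unfold psiDO
    simp only [mul_assoc (a _)]
    refine tendsto_integral_of_dominated_convergence _ (fun k =>
      (hcont k).aestronglyMeasurable.mul hΦ.aestronglyMeasurable) (hΦ.norm.const_mul A)
      (fun k => Eventually.of_forall fun ξ => ?_)
      (Eventually.of_forall fun ξ => (hlim ξ).mul_const _)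
    rw [norm_mul, norm_mul]
    refine mul_le_mul_of_nonneg_right ?_ (norm_nonneg _)
    exact (mul_le_mul (hbA ξ) (hχ1 k ξ) (norm_nonneg _) hA).trans (mul_one A).le
  simp only [fun k => integral_mul_prod_hat_eq (hint k) f x] at hleft
  exact tendsto_nhds_unique hleft hright

end

end MultPsiDO

end

theorem proposition4p1 (m n : ℕ) (hm : 1 ≤ m) (hn : 1 ≤ n) (δ : ℝ) (hδ0 : 0 ≤ δ) (hδ1 : δ < 1)
    (a : MultPsiDO.Phase m n → ℂ) (ha : MultPsiDO.IsSymbol 0 1 δ a) :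
    ∃ K : (Fin (m + 1) → MultPsiDO.E n) → ℂ,
      MultPsiDO.IsAssociatedKernel (MultPsiDO.psiDO a) K ∧
      MultPsiDO.DecayCondition K ∧
      MultPsiDO.SmoothnessCondition K := by
  have : NeZero m := ⟨by omega⟩
  have : NeZero n := ⟨by omega⟩
  exact ⟨MultPsiDO.opKernel a, ha.isAssociatedKernel, ha.decayCondition,
    ha.smoothnessCondition hδ1.le⟩
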